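/- **Setting.** The arm space is $[0,1]$. In each round $t=1,2,\dots$ the player chooses an arm $X_t\in[0,1]$ and receives a reward $Y_t$ which, given $X_t$, is independent of the past, has conditional mean $f(X_t)$, where $f:[0,1]\to[0,1]$ is measurable and unknown, and is such that $Y_t-f(X_t)$ is conditionally $(1/4)$-subgaussian: $\mathbb E[e^{\lambda (Y_t-f(X_t))}\mid X_t]\le e^{\lambda^2/8}$ for all $\lambda\in\mathbb R$. With $M(f)=\max f$, the regret is $\overline R_T = T M(f)-\mathbb E\big[\sum_{t=1}^T f(X_t)\big]$. For $L,\alpha>0$, $\mathcal H(L,\alpha)$ is the set of functions $f:[0,1]\to[0,1]$ for which there is $x^\star\in[0,1]$ with $f(x^\star)=M(f)$ and $|f(x^\star)-f(x)|\le L|x^\star-x|^\alpha$ for all $x\in[0,1]$. **MOSS.** With $K$ arms and horizon $n$, MOSS pulls in each round an arm $a$ that maximizes $\hat\mu_a+\sqrt{\max(\log(n/(K N_a)),0)/N_a}$, where $N_a$ is the number of past pulls of $a$ and $\hat\mu_a$ the average of the rewards they gave (the index is $+\infty$ if $N_a=0$); ties are broken arbitrarily. **MeDZO.** Given $B$ and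 $T$, let $p=\lceil\log_2 B\rceil$ and, for $i=1,\dots,p$, $K_i=2^{p+2-i}$ and $\Delta T_i=2^{p+i}$. The algorithm plays in successive regimes $i=1,\dots,p$, of $\Delta T_i$ rounds each, and is stopped after $T$ rounds in total. In regime $i$ the discrete arms are the $K_i$ uniform distributions on the intervals $[(k-1)/K_i,k/K_i]$, $1\le k\le K_i$, and the $i-1$ empirical measures $\hat\nu_j$ of the arms $X_t$ played during the regimes $j<i$. In each round, a fresh run of MOSS (restarted at the beginning of the regime, with horizon $\Delta T_i$, on these $K_i+i-1$ discrete arms) selects a discrete arm, $X_t$ is drawn from the corresponding distribution, and the reward $Y_t$ is given to MOSS as the reward of that discrete arm. **Theorem.** Let $T$ be a nonnegative integer and let $B\ge\sqrt T$ with $B\ge\sqrt 2$ (the latter is automatic if $T\ge2$). Then MeDZO, run with the knowledge of $T$ and input $B$, satisfies, for all $\alpha>0$ and $L>0$, $$\sup_{f\in\mathcal H(L,\alpha)}\overline R_T\;\le\;412\,(\log_2 B)^{3/2}\,\max\Big(B,\;T\,L^{1/(\alpha+1)}B^{-\alpha/(\alpha+1)}\Big).$$ -/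

import Mathlib

open MeasureTheory ProbabilityTheory
open scoped unitInterval ENNReal NNReal

noncomputable section

namespace MeDZO

/-! ### The continuum-armed bandit problem on `[0, 1]` -/

/-- The class `H(L, α)` of mean-payoff functions `f : [0, 1] → [0, 1]` that attain their maximum
at some `x⋆` around which they satisfy a Hölder condition. -/
def holderClass (L α : ℝ) : Set (I → ℝ) :=
  {f | (∀ x, f x ∈ Set.Icc (0 : ℝ) 1) ∧
    ∃ xstar : I, (∀ x, f x ≤ f xstar) ∧
      ∀ x : I, |f xstar - f x| ≤ L * |(xstar : ℝ) - (x : ℝ)| ^ α}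

/-- The reward laws `ν t x` (law of the reward received when arm `x` is played in round `t`)
form an environment with mean-payoff function `f`: they have mean `f x` and are
`1/4`-subgaussian, i.e. `∫ exp (r (y - f x)) dν t x (y) ≤ exp (r ^ 2 / 8)` for all real `r`. -/
structure IsEnvironment (f : I → ℝ) (ν : ℕ → Kernel I ℝ) : Prop where
  isMarkovKernel : ∀ t, IsMarkovKernel (ν t)
  integral_eq : ∀ t x, ∫ y, y ∂(ν t x) = f x
  subgaussian : ∀ t x, HasSubgaussianMGF (fun y => y - f x) (1 / 4) (ν t x)

/-- Expected cumulative pseudo-regret `T M(f) - E[∑_{t < T} f (X_t)]` of the plays `X`. Rounds are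
numbered from `0`. -/
def regret {Ω : Type*} [MeasurableSpace Ω] (P : Measure Ω) (f : I → ℝ) (T : ℕ)
    (X : ℕ → Ω → I) : ℝ :=
  T * (⨆ x, f x) - ∫ ω, ∑ t ∈ Finset.range T, f (X t ω) ∂P

/-! ### The finite-armed algorithm MOSS

`A r` and `Y r` are the index of the arm pulled and the reward received in round `r`. The
algorithm is started at round `s`, with the arms `0, …, K - 1` and the horizon `n`. -/

/-- The number of pulls of arm `a` in the rounds `s, …, t - 1`. -/
def pulls (A : ℕ → ℕ) (s t a : ℕ) : ℕ := ((Finset.Ico s t).filter (fun r => A r = a)).card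

/-- The average reward of arm `a` in the rounds `s, …, t - 1`. -/
def empiricalMean (A : ℕ → ℕ) (Y : ℕ → ℝ) (s t a : ℕ) : ℝ :=
  (∑ r ∈ (Finset.Ico s t).filter (fun r => A r = a), Y r) / pulls A s t a

/-- The MOSS index of arm `a` at the beginning of round `t`. -/
def mossIndex (n K : ℕ) (A : ℕ → ℕ) (Y : ℕ → ℝ) (s t a : ℕ) : EReal :=
  if pulls A s t a = 0 then ⊤
  else ((empiricalMean A Y s t a
    + √(max (Real.log ((n : ℝ) / (K * pulls A s t a))) 0 / pulls A s t a) : ℝ) : EReal)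

/-- The arm pulled in round `t` is one of the `K` arms, and it has maximal MOSS index
(ties are broken arbitrarily). -/
def IsMossChoice (n K : ℕ) (A : ℕ → ℕ) (Y : ℕ → ℝ) (s t : ℕ) : Prop :=
  A t < K ∧ ∀ b < K, mossIndex n K A Y s t b ≤ mossIndex n K A Y s t (A t)

/-! ### The algorithm MeDZO -/

/-- The number `p = ⌈log₂ B⌉` of regimes. -/
def numRegimes (B : ℝ) : ℕ := ⌈Real.logb 2 B⌉₊

/-- The number `K_i` of cells of the uniform discretization used in regime `i ∈ {1, …, p}`. -/
def numCells (p i : ℕ) : ℕ := 2 ^ (p + 2 - i)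

/-- The length `ΔT_i` of regime `i`. -/
def regimeLength (p i : ℕ) : ℕ := 2 ^ (p + i)

/-- The total length `T_i` of the regimes `1, …, i`. Regime `i` consists of the rounds
`T_{i-1}, …, T_i - 1`. -/
def regimeEnd (p i : ℕ) : ℕ := ∑ j ∈ Finset.Icc 1 i, regimeLength p j

/-- The number of discrete arms in regime `i`: the `K_i` cells, and the `i - 1` previous regimes. -/
def numArms (p i : ℕ) : ℕ := numCells p i + (i - 1)

/-- Uniform distribution on the `k`-th cell (`k = 0, …, K - 1`) of the regular partition of `[0, 1]`
into `K` intervals. -/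
def cellLaw (K k : ℕ) : Measure I :=
  (volume : Measure I)[|{x : I | (k : ℝ) / K ≤ (x : ℝ) ∧ (x : ℝ) ≤ ((k : ℝ) + 1) / K}]

/-- What is recorded in the first `t` rounds: discrete arms, plays and rewards. -/
abbrev History (t : ℕ) : Type := Fin t → ℕ × I × ℝ

/-- The empirical measure of the plays of regime `j`. It is used only once that regime is over,
so that all its rounds are in the history. -/
def playsLaw (p j t : ℕ) (h : History t) : Measure I :=
  ((regimeLength p j : ℕ) : ℝ≥0∞)⁻¹ •
    ∑ s : Fin t, if regimeEnd p (j - 1) ≤ (s : ℕ) ∧ (s : ℕ) < regimeEnd p j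
      then Measure.dirac (h s).2.1 else 0

/-- The distribution on `[0, 1]` attached in regime `i` to the discrete arm `a < numArms p i`: the
uniform distribution on cell `a` if `a < K_i`, and the empirical measure of the plays of regime
`j` if `a = K_i + (j - 1)`, `1 ≤ j < i`. -/
def armLaw (p i t : ℕ) (q : History t × ℕ) : Measure I :=
  if q.2 < numCells p i then cellLaw (numCells p i) q.2
  else playsLaw p (q.2 - numCells p i + 1) t q.1

theorem measurable_armLaw (p i t : ℕ) : Measurable (armLaw p i t) := by
  refine measurable_from_prod_countable_left fun a => ?_
  unfold armLaw
  by_cases ha : a < numCells p i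
  · simp only [ha, if_true]
    exact measurable_const
  · simp only [ha, if_false]
    refine Measure.measurable_of_measurable_coe _ fun s hs => ?_
    simp only [playsLaw, Measure.smul_apply, Measure.finsetSum_apply, smul_eq_mul]
    refine Measurable.const_mul (Finset.measurable_sum _ fun r _ => ?_) _
    split_ifs
    · exact (Measure.measurable_coe hs).comp
        (Measure.measurable_dirac.comp (measurable_pi_apply r).snd.fst)
    · exact measurable_const

/-- `armLaw` as a transition kernel. -/
def armKernel (p i t : ℕ) : Kernel (History t × ℕ) I := ⟨armLaw p i t, measurable_armLaw p i t⟩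

instance (p i t : ℕ) : IsFiniteKernel (armKernel p i t) := by
  refine ⟨⟨1 + t, by simp, fun q => ?_⟩⟩
  change armLaw p i t q Set.univ ≤ _
  unfold armLaw
  split_ifs with hq
  · have : cellLaw (numCells p i) q.2 Set.univ ≤ 1 := by
      unfold cellLaw
      exact prob_le_one
    exact this.trans (by simp)
  · simp only [playsLaw, Measure.smul_apply, Measure.finsetSum_apply, smul_eq_mul]
    have h1 : ((regimeLength p (q.2 - numCells p i + 1) : ℕ) : ℝ≥0∞)⁻¹ ≤ 1 := by
      rw [ENNReal.inv_le_one]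
      exact_mod_cast Nat.one_le_two_pow
    refine (mul_le_mul' h1 (Finset.sum_le_sum (g := fun _ => 1) fun r _ => ?_)).trans ?_
    · split_ifs <;> simp
    · simp

/-- What is recorded before round `t`. -/
def history {Ω : Type*} (A : ℕ → Ω → ℕ) (X : ℕ → Ω → I) (Y : ℕ → Ω → ℝ) (t : ℕ) (ω : Ω) :
    History t :=
  fun s => (A s ω, X s ω, Y s ω)

/-- The law of the reward of round `t`, as a transition kernel from the past, the discrete arm and
the play: it depends on the play only. -/
def rewardKernel (ν : ℕ → Kernel I ℝ) (t : ℕ) : Kernel ((History t × ℕ) × I) ℝ :=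
  (ν t).comap Prod.snd measurable_snd

/-- `A`, `X`, `Y` (discrete arms, plays, rewards) form a run of MeDZO with input `B`, for `T` rounds,
against the reward laws `ν`. -/
structure IsRun {Ω : Type*} [MeasurableSpace Ω] (P : Measure Ω) (B : ℝ) (T : ℕ)
    (ν : ℕ → Kernel I ℝ) (A : ℕ → Ω → ℕ) (X : ℕ → Ω → I) (Y : ℕ → Ω → ℝ) : Prop where
  measurable_arm : ∀ t, Measurable (A t)
  measurable_play : ∀ t, Measurable (X t)
  measurable_reward : ∀ t, Measurable (Y t)
  /-- In regime `i`, the discrete arm is chosen by MOSS, restarted at the beginning of the regime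
  and run with horizon `ΔT_i`. -/
  arm : ∀ i ∈ Finset.Icc 1 (numRegimes B),
    ∀ t ∈ Finset.Ico (regimeEnd (numRegimes B) (i - 1)) (regimeEnd (numRegimes B) i), t < T →
      ∀ᵐ ω ∂P, IsMossChoice (regimeLength (numRegimes B) i) (numArms (numRegimes B) i)
        (fun r => A r ω) (fun r => Y r ω) (regimeEnd (numRegimes B) (i - 1)) t
  /-- Given the past and the discrete arm, the play is drawn from the distribution attached to
  that arm. -/
  play : ∀ i ∈ Finset.Icc 1 (numRegimes B),
    ∀ t ∈ Finset.Ico (regimeEnd (numRegimes B) (i - 1)) (regimeEnd (numRegimes B) i), t < T →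
      HasCondDistrib (X t) (fun ω => (history A X Y t ω, A t ω)) (armKernel (numRegimes B) i t) P
  /-- Given the past, the discrete arm and the play `x`, the reward has law `ν t x`. -/
  reward : ∀ t < T,
    HasCondDistrib (Y t) (fun ω => ((history A X Y t ω, A t ω), X t ω)) (rewardKernel ν t) P

end MeDZO

end

noncomputable section

namespace MeDZO

/-! ### Elementary inequalities -/

/-! Each regime is one run of MOSS. Write `K_i` for the number of cells and `ΔT_i` for the length of
regime `i`. The grid gets coarser as the regime gets longer, with `K_i ΔT_i = 4 · 4^p` in every
regime. Counting the arms that replay earlier regimes, arms times horizon is at most `4^p (p + 3)`,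
so MOSS loses at most `D = 40 · 2^p √(p + 3)` in every regime, against any fixed arm of that regime.

Two comparison arms suffice. The cell containing a maximizer costs a bias of at most `L K_i^(-α)`
per round. The arm replaying regime `j < i` costs the average regret of regime `j`, at most `L
K_j^(-α) + D / ΔT_j`. Let `κ = (L B)^(1/(α+1))`, the grid size whose bias `Λ = L κ^(-α)` equals `κ /
B`. As long as `K_i ≥ κ`, the cell is used. Afterwards some regime `j` with `κ ≤ K_j ≤ 2κ` is over,
and replaying it costs at most `Λ + D κ / (2 · 4^p)` per round (`sum_le_of_two_controls`). Adding up
the regimes gives `IsRun.regret_le`, without any knowledge of `L` and `α` by the algorithm.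

The MOSS bound `40 √(K n)` (`IsSubgaussianFeedback.moss_regret_le`) needs no maximal inequality. By
`u ≤ exp (u - 1)`, every positive part that appears is bounded along each path by a combination of
the exponentials `exp (l S - l² N / 4)`, where `S` is the centred reward sum and `N` the number of
pulls of an arm. These have expectation at most 1 at fixed times, and also when stopped at a given
pull. For the comparison arm the unknown `N` is handled by peeling into blocks `[4^k, 4^(k+1)]`
(`shortfall_le_sum`). For the arm pulled, each pair (arm, number of earlier pulls) occurs at most
once (`lintegral_pulled_le`). The means of the arms are random, since earlier plays define some of
them, but they are fixed when the regime begins. -/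

theorem mul_le_exp_mul_sub_one (l x : ℝ) : l * x ≤ Real.exp (l * x - 1) := by
  have := Real.add_one_le_exp (l * x - 1)
  linarith

/-- The width of the MOSS confidence bound after `k` pulls, where `x` is the ratio of the horizon
to the number of arms. -/
def width (x : ℝ) (k : ℕ) : ℝ := √(max (Real.log (x / k)) 0 / k)

theorem width_nonneg (x : ℝ) (k : ℕ) : 0 ≤ width x k := Real.sqrt_nonneg _

/-- Exponential bound on the excess of a deviation over a fixed threshold. -/
theorem excess_le_exp {k : ℕ} (hk : 1 ≤ k) {d : ℝ} (hd : 0 < d) (S : ℝ) :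
    max (S / k - d) 0 ≤ Real.exp (-(k * d ^ 2)) / (2 * √k) *
      Real.exp ((2 * d + 2 / √k) * S - (2 * d + 2 / √k) ^ 2 / 4 * k) := by
  have hk0 : (0 : ℝ) < k := by exact_mod_cast hk
  have hs : 0 < √(k : ℝ) := Real.sqrt_pos.2 hk0
  have hss : √(k : ℝ) ^ 2 = k := Real.sq_sqrt hk0.le
  generalize √(k : ℝ) = q at hs hss ⊢
  refine max_le ?_ (by positivity)
  -- `2 * d` is the Chernoff rate for the threshold `d`. The extra `2 / q` makes the exponent,
  -- including its `-1`, exactly `-k d² + l S - l² k / 4`, and ensures `k l ≥ 2 √k`.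
  set l : ℝ := 2 * d + 2 / q with hl
  have hl0 : 0 < l := by positivity
  have h1 := mul_le_exp_mul_sub_one l (S - k * d)
  have hexp : l * (S - k * d) - 1 = -(k * d ^ 2) + (l * S - l ^ 2 / 4 * k) := by
    rw [hl, ← hss]; field_simp; ring
  rw [hexp, Real.exp_add] at h1
  have hkl : 2 * q ≤ k * l := by
    rw [hl]
    have : (k : ℝ) * (2 / q) = 2 * q := by rw [← hss]; field_simp
    have h2 : 0 ≤ (k : ℝ) * (2 * d) := by positivity
    linarith
  have h3 : S / k - d = l * (S - k * d) / (k * l) := by field_simp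
  rw [h3, div_mul_eq_mul_div]
  refine (div_le_div_of_nonneg_right h1 (by positivity)).trans ?_
  exact div_le_div_of_nonneg_left (by positivity) (by positivity) hkl

theorem log_le_sqrt {x : ℝ} (hx : 0 < x) : Real.log x ≤ √x := by
  have hs : 0 < √x := Real.sqrt_pos.2 hx
  have h1 : Real.log x = 2 * Real.log √x := by
    rw [Real.log_sqrt hx.le]; ring
  have h4 : Real.log √x ≤ √x / Real.exp 1 := by
    have := Real.add_one_le_exp (Real.log √x - 1)
    rw [Real.exp_sub, Real.exp_log hs] at this
    linarith
  have he : (2 : ℝ) ≤ Real.exp 1 := by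
    have := Real.add_one_le_exp (1 : ℝ); linarith
  have : √x / Real.exp 1 ≤ √x / 2 := div_le_div_of_nonneg_left hs.le (by norm_num) he
  linarith

/-- Since `log y ≤ √y`, the width is at most `x^(1/4) / k^(3/4)`, which is at most the increment of
`4 x^(1/4) k^(1/4)`; it vanishes once `k ≥ x`. The term `k = 0` is zero because division by zero is.
-/
theorem sum_width_le {x : ℝ} (hx : 0 < x) (M : ℕ) :
    ∑ k ∈ Finset.range M, width x k ≤ 4 * √x := by
  set q : ℝ := √√x with hq
  have hq0 : 0 < q := Real.sqrt_pos.2 (Real.sqrt_pos.2 hx)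
  have hq2 : q ^ 2 = √x := Real.sq_sqrt (Real.sqrt_nonneg _)
  have key : ∀ M : ℕ, ∑ k ∈ Finset.range (M + 1), width x k ≤ 4 * q * min (√√(M : ℝ)) q := by
    intro M
    induction M with
    | zero => simp [width, hq0.le]
    | succ M ih =>
      rw [Finset.sum_range_succ]
      set u : ℝ := √√((M + 1 : ℕ) : ℝ) with hu
      set v : ℝ := √√(M : ℝ) with hv
      have hM : (0 : ℝ) < ((M + 1 : ℕ) : ℝ) := by positivity
      have hu0 : 0 < u := Real.sqrt_pos.2 (Real.sqrt_pos.2 hM)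
      have hv0 : 0 ≤ v := Real.sqrt_nonneg _
      have hu2 : u ^ 2 = √((M + 1 : ℕ) : ℝ) := Real.sq_sqrt (Real.sqrt_nonneg _)
      have hu4 : u ^ 4 = M + 1 := by
        rw [show u ^ 4 = (u ^ 2) ^ 2 by ring, hu2, Real.sq_sqrt hM.le]; push_cast; ring
      have hv4 : v ^ 4 = M := by
        rw [show v ^ 4 = (v ^ 2) ^ 2 by ring, hv, Real.sq_sqrt (Real.sqrt_nonneg _),
          Real.sq_sqrt (Nat.cast_nonneg M)]
      have huv : v ≤ u := by
        apply Real.sqrt_le_sqrt; apply Real.sqrt_le_sqrt; push_cast; linarith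
      rcases le_or_gt ((M + 1 : ℕ) : ℝ) x with h | h
      · have huq : u ≤ q := Real.sqrt_le_sqrt (Real.sqrt_le_sqrt h)
        rw [min_eq_left (huv.trans huq)] at ih
        rw [min_eq_left huq]
        have hw : width x (M + 1) ≤ q / u ^ 3 := by
          rw [width]
          apply Real.sqrt_le_iff.2 ⟨by positivity, ?_⟩
          have h1 : max (Real.log (x / (M + 1 : ℕ))) 0 ≤ √(x / (M + 1 : ℕ)) :=
            max_le (log_le_sqrt (by positivity)) (Real.sqrt_nonneg _)
          refine (div_le_div_of_nonneg_right h1 hM.le).trans (le_of_eq ?_)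
          rw [Real.sqrt_div hx.le, ← hu2, ← hq2]
          push_cast
          rw [← hu4]
          field_simp
        have h2 : 1 ≤ (u - v) * (4 * u ^ 3) := by
          have e : (u - v) * ((u + v) * (u ^ 2 + v ^ 2)) = 1 := by
            have : u ^ 4 - v ^ 4 = 1 := by rw [hu4, hv4]; ring
            linarith
          have : (u + v) * (u ^ 2 + v ^ 2) ≤ (2 * u) * (2 * u ^ 2) := by
            have : v ^ 2 ≤ u ^ 2 := by gcongr
            apply mul_le_mul <;> first | positivity | linarith
          have := mul_le_mul_of_nonneg_left this (sub_nonneg.2 huv)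
          linarith
        have h3 : q / u ^ 3 ≤ 4 * q * (u - v) := by
          rw [div_le_iff₀ (by positivity)]
          have := mul_le_mul_of_nonneg_left h2 hq0.le
          linarith
        linarith
      · have hw : width x (M + 1) = 0 := by
          rw [width, max_eq_right, zero_div, Real.sqrt_zero]
          exact Real.log_nonpos (by positivity) ((div_le_one hM).2 h.le)
        rw [hw, add_zero]
        refine ih.trans ?_
        gcongr
  cases M with
  | zero => simp
  | succ M =>
    refine (key M).trans ?_
    rw [← hq2]
    have := min_le_right (√√(M : ℝ)) q
    nlinarith

/-- Up to `k = x` the terms are dominated by the increments of `√k`. Beyond, `1 / (2√k) ≤ 1 / √x`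
and the exponentials `exp (-k / x)` telescope. Each range contributes at most `√x`. -/
theorem sum_exp_div_sqrt_le {x : ℝ} (hx : 0 < x) (M : ℕ) :
    ∑ k ∈ Finset.range M, Real.exp (-(k * (1 / √x) ^ 2)) / (2 * √(k : ℝ)) ≤ 2 * √x := by
  have hq0 : 0 < √x := Real.sqrt_pos.2 hx
  have hq2 : √x ^ 2 = x := Real.sq_sqrt hx.le
  have key : ∀ M : ℕ, ∑ k ∈ Finset.range (M + 1),
      Real.exp (-(k * (1 / √x) ^ 2)) / (2 * √(k : ℝ)) ≤
        min (√(M : ℝ)) √x + √x * (1 - Real.exp (-(M * (1 / √x) ^ 2))) := by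
    intro M
    induction M with
    | zero => simp
    | succ M ih =>
      rw [Finset.sum_range_succ]
      have hM : (0 : ℝ) < ((M + 1 : ℕ) : ℝ) := by positivity
      set u : ℝ := √((M + 1 : ℕ) : ℝ) with hu
      set v : ℝ := √(M : ℝ) with hv
      have hu0 : 0 < u := Real.sqrt_pos.2 hM
      have hv0 : 0 ≤ v := Real.sqrt_nonneg _
      have hu2 : u ^ 2 = M + 1 := by rw [hu, Real.sq_sqrt hM.le]; push_cast; ring
      have hv2 : v ^ 2 = M := Real.sq_sqrt (Nat.cast_nonneg M)
      have huv : v ≤ u := by apply Real.sqrt_le_sqrt; push_cast; linarith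
      set E : ℝ := Real.exp (-(((M + 1 : ℕ) : ℝ) * (1 / √x) ^ 2)) with hE
      have hE0 : 0 < E := Real.exp_pos _
      have hE1 : E ≤ 1 := Real.exp_le_one_iff.2 (by rw [neg_nonpos]; positivity)
      have hstep : E * (1 + (1 / √x) ^ 2) ≤ Real.exp (-(M * (1 / √x) ^ 2)) := by
        have : Real.exp (-(M * (1 / √x) ^ 2)) = E * Real.exp ((1 / √x) ^ 2) := by
          rw [hE, ← Real.exp_add]; congr 1; push_cast; ring
        rw [this]
        gcongr
        have := Real.add_one_le_exp ((1 / √x) ^ 2)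
        linarith
      have hgap : E / √x ≤ √x * (Real.exp (-(M * (1 / √x) ^ 2)) - E) := by
        have h1 : E / √x = √x * (E * (1 / √x) ^ 2) := by field_simp
        rw [h1]
        gcongr
        linarith
      have hmin : min v √x ≤ min u √x := min_le_min huv le_rfl
      rcases le_or_gt ((M + 1 : ℕ) : ℝ) x with h | h
      · have huq : u ≤ √x := Real.sqrt_le_sqrt h
        rw [min_eq_left (huv.trans huq)] at ih
        rw [min_eq_left huq]
        have h3 : E / (2 * u) ≤ u - v := by
          rw [div_le_iff₀ (by positivity)]
          nlinarith
        have : 0 ≤ E / √x := by positivity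
        linarith
      · have huq : √x ≤ u := Real.sqrt_le_sqrt h.le
        have h3 : E / (2 * u) ≤ E / √x :=
          div_le_div_of_nonneg_left hE0.le hq0 (by linarith)
        linarith
  cases M with
  | zero => simp
  | succ M =>
    refine (key M).trans ?_
    have := min_le_right √(M : ℝ) √x
    have h2 : 0 ≤ √x * Real.exp (-(M * (1 / √x) ^ 2)) := by positivity
    linarith

/-- Exponential bound on the excess over the MOSS width, for numbers of pulls in `[m, 4m]`. -/
theorem shortfall_le_exp {m N c w : ℝ} (hm : 0 < m) (hmN : m ≤ N) (hN : N ≤ 4 * m)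
    (hc : 0 ≤ c) (hw : c / √N ≤ w) (S : ℝ) :
    max (-(S / N) - w) 0 ≤ 4 / 3 / √m * Real.exp (-(3 / 4 * c ^ 2)) *
      Real.exp (-((4 / 3 * c + 1 / 2) / √m) * S
        - (-((4 / 3 * c + 1 / 2) / √m)) ^ 2 / 4 * N) := by
  have hN0 : 0 < N := hm.trans_le hmN
  set r : ℝ := √m with hr
  have hr0 : 0 < r := Real.sqrt_pos.2 hm
  have hr2 : r ^ 2 = m := Real.sq_sqrt hm.le
  -- One rate must serve every `N` in `[m, 4m]`. With `√N` replaced by its chord the exponent is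
  -- affine in `N`, and the slope `4 / 3` makes its `c²` coefficient independent of `N`. The `1 / 2`
  -- keeps `m l` away from zero when `c = 0`.
  set l : ℝ := (4 / 3 * c + 1 / 2) / r with hl
  have hl0 : 0 < l := by positivity
  have hsN : 0 < √N := Real.sqrt_pos.2 hN0
  have hsN2 : √N ^ 2 = N := Real.sq_sqrt hN0.le
  refine max_le ?_ (by positivity)
  have h1 := mul_le_exp_mul_sub_one l (-S - c * √N)
  -- `√N` lies above its chord on `[m, 4m]`
  have hchord : (2 * m + N) / (3 * r) ≤ √N := by
    rw [div_le_iff₀ (by positivity)]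
    have ha : r ≤ √N := Real.sqrt_le_sqrt hmN
    have hb : √N ≤ 2 * r := by
      rw [Real.sqrt_le_left (by positivity), mul_pow, hr2]; linarith
    nlinarith [mul_nonneg (sub_nonneg.2 ha) (sub_nonneg.2 hb)]
  have hexp : l * (-S - c * √N) - 1 ≤ -(1 / 2) + (-(3 / 4 * c ^ 2) + (-l * S - (-l) ^ 2 / 4 * N)) := by
    have h2 : l * c * ((2 * m + N) / (3 * r)) ≤ l * c * √N := by gcongr
    have h3 : l ^ 2 / 4 * N - l * c * ((2 * m + N) / (3 * r)) + 3 / 4 * c ^ 2 ≤ 1 / 2 := by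
      obtain ⟨y, hy⟩ : ∃ y, N = m * y := ⟨N / m, by field_simp⟩
      have hy1 : 1 ≤ y := by
        by_contra h; push Not at h; nlinarith
      have hy4 : y ≤ 4 := by
        by_contra h; push Not at h; nlinarith
      have e : l ^ 2 / 4 * N - l * c * ((2 * m + N) / (3 * r)) =
          (4 / 3 * c + 1 / 2) ^ 2 / 4 * y - (4 / 3 * c + 1 / 2) * c * (2 + y) / 3 := by
        rw [hl, hy, ← hr2]; field_simp
      rw [e]
      -- The left side is `-5c²/36 + (y - 2)c/6 + y/16`. It is largest at `y = 4`, where it peaks at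
      -- `c = 6/5` with value `9/20`.
      nlinarith [mul_nonneg (sub_nonneg.2 hy4) (mul_nonneg hc hc), mul_nonneg (sub_nonneg.2 hy1) hc,
        mul_nonneg (sub_nonneg.2 hy4) hc, sq_nonneg (c - 6 / 5),
        mul_nonneg (sub_nonneg.2 hy1) (sq_nonneg (c - 6 / 5)),
        mul_nonneg (sub_nonneg.2 hy4) (sq_nonneg (c - 6 / 5))]
    linarith
  have h4 : l * (-S - c * √N) ≤ 2 / 3 * (Real.exp (-(3 / 4 * c ^ 2)) *
      Real.exp (-l * S - (-l) ^ 2 / 4 * N)) := by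
    refine h1.trans ((Real.exp_le_exp.2 hexp).trans ?_)
    rw [Real.exp_add, Real.exp_add]
    gcongr
    rw [Real.exp_neg, inv_le_comm₀ (Real.exp_pos _) (by norm_num)]
    have := Real.add_one_le_exp (1 / 2 : ℝ)
    norm_num at this ⊢
    linarith
  rcases le_or_gt (-S - c * √N) 0 with hneg | hpos
  · refine le_trans ?_ (by positivity)
    have : -(S / N) - c / √N ≤ 0 := by
      have e : -(S / N) - c / √N = (-S - c * √N) / N := by
        rw [← hsN2, Real.sqrt_sq hsN.le]; field_simp
      rw [e]
      exact div_nonpos_of_nonpos_of_nonneg hneg hN0.le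
    linarith
  · have h5 : -(S / N) - w ≤ (-S - c * √N) / m := by
      have e : -(S / N) - c / √N = (-S - c * √N) / N := by
        rw [← hsN2, Real.sqrt_sq hsN.le]; field_simp
      have : (-S - c * √N) / N ≤ (-S - c * √N) / m := div_le_div_of_nonneg_left hpos.le hm hmN
      linarith
    refine h5.trans ?_
    have h6 : (-S - c * √N) / m = l * (-S - c * √N) / (m * l) := by field_simp
    rw [h6]
    refine (div_le_div_of_nonneg_right h4 (by positivity)).trans ?_
    have hml : r / 2 ≤ m * l := by
      have : m * l = r * (4 / 3 * c + 1 / 2) := by rw [hl, ← hr2]; field_simp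
      rw [this]; nlinarith
    refine (div_le_div_of_nonneg_left (by positivity) (by positivity) hml).trans (le_of_eq ?_)
    field_simp
    norm_num

/-- A two-sided geometric sum, bounded by telescoping `z / (1 + z)`. -/
theorem sum_min_geom_le {z : ℝ} (hz : 0 < z) (n : ℕ) :
    ∑ k ∈ Finset.range n, min (z * √2 ^ k) (1 / (z * √2 ^ k)) ≤ 12 := by
  have h2 : √(2 : ℝ) ^ 2 = 2 := Real.sq_sqrt (by norm_num)
  have hlo : (1.41 : ℝ) ≤ √2 := Real.le_sqrt_of_sq_le (by norm_num)
  have hhi : √(2 : ℝ) ≤ 1.42 := Real.sqrt_le_iff.2 ⟨by norm_num, by norm_num⟩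
  -- `12` rounds up `2 (1 + √2)² ≈ 11.66`, the ratio of the two sides at the worst point `y = 1`.
  have step : ∀ y : ℝ, 0 < y →
      min y (1 / y) ≤ 12 * (√2 * y / (1 + √2 * y) - y / (1 + y)) := by
    intro y hy
    have e : √2 * y / (1 + √2 * y) - y / (1 + y) =
        (√2 - 1) * y / ((1 + √2 * y) * (1 + y)) := by
      field_simp; ring
    rw [e]
    rcases le_or_gt y 1 with h | h
    · refine (min_le_left _ _).trans ?_
      rw [mul_div_assoc', le_div_iff₀ (by positivity)]
      have : (1 + √2 * y) * (1 + y) ≤ 12 * (√2 - 1) := by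
        have : √2 * y ≤ √2 := by nlinarith
        nlinarith
      nlinarith
    · refine (min_le_right _ _).trans ?_
      rw [mul_div_assoc', le_div_iff₀ (by positivity), one_div, inv_mul_le_iff₀ hy]
      have : (1 + √2 * y) * (1 + y) ≤ ((1 + √2) * y) * (2 * y) := by
        apply mul_le_mul <;> first | positivity | nlinarith
      nlinarith [mul_pos hy hy]
  have key : ∑ k ∈ Finset.range n, min (z * √2 ^ k) (1 / (z * √2 ^ k)) ≤
      12 * (z * √2 ^ n / (1 + z * √2 ^ n) - z / (1 + z)) := by
    induction n with
    | zero => simp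
    | succ n ih =>
      rw [Finset.sum_range_succ]
      have := step (z * √2 ^ n) (by positivity)
      have e : √2 * (z * √2 ^ n) = z * √2 ^ (n + 1) := by ring
      rw [e] at this
      linarith
  refine key.trans ?_
  have h1 : z * √2 ^ n / (1 + z * √2 ^ n) ≤ 1 := by
    rw [div_le_one (by positivity)]; linarith
  have h2 : 0 ≤ z / (1 + z) := by positivity
  linarith

/-- Coefficients of the exponentials in the peeling bound `shortfall_le_sum`. -/
def peelCoeff (x : ℝ) (k : ℕ) : ℝ :=
  4 / 3 / √(4 ^ k) * Real.exp (-(3 / 4 * √(max (Real.log (x / 4 ^ (k + 1))) 0) ^ 2))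

/-- Exponents of the exponentials in the peeling bound `shortfall_le_sum`. -/
def peelRate (x : ℝ) (k : ℕ) : ℝ :=
  -((4 / 3 * √(max (Real.log (x / 4 ^ (k + 1))) 0) + 1 / 2) / √(4 ^ k))

theorem peelCoeff_nonneg (x : ℝ) (k : ℕ) : 0 ≤ peelCoeff x k := by
  unfold peelCoeff; positivity

/-- Only the block `k = ⌊log₄ N⌋` is needed. Summing over all `k` removes the dependence of
coefficients and rates on the random `N`, so that expectations can be taken term by term. -/
theorem shortfall_le_sum {x : ℝ} (hx : 0 < x) {N n : ℕ} (hN : 1 ≤ N) (hn : N ≤ n) (S : ℝ) :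
    max (-(S / N) - width x N) 0 ≤ ∑ k ∈ Finset.range n,
      peelCoeff x k * Real.exp (peelRate x k * S - peelRate x k ^ 2 / 4 * N) := by
  set k := Nat.log 4 N with hk
  have hlo : 4 ^ k ≤ N := Nat.pow_log_le_self 4 (by omega)
  have hhi : N < 4 ^ (k + 1) := Nat.lt_pow_succ_log_self (by norm_num) N
  have hkn : k ∈ Finset.range n := by
    rw [Finset.mem_range]
    exact lt_of_lt_of_le ((Nat.lt_pow_self (by norm_num)).trans_le hlo) hn
  refine le_trans ?_ (Finset.single_le_sum (f := fun k => peelCoeff x k *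
    Real.exp (peelRate x k * S - peelRate x k ^ 2 / 4 * N))
    (fun j _ => mul_nonneg (peelCoeff_nonneg x j) (Real.exp_pos _).le) hkn)
  have hlo' : (4 : ℝ) ^ k ≤ N := by exact_mod_cast hlo
  have hhi' : (N : ℝ) ≤ 4 * 4 ^ k := by
    have : (N : ℝ) ≤ (4 : ℝ) ^ (k + 1) := by exact_mod_cast hhi.le
    rwa [pow_succ, mul_comm] at this
  have hN0 : (0 : ℝ) < N := by exact_mod_cast hN
  refine shortfall_le_exp (by positivity) hlo' hhi' (Real.sqrt_nonneg _) ?_ S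
  rw [width, ← Real.sqrt_div (le_max_right _ _)]
  apply Real.sqrt_le_sqrt
  gcongr
  · rw [pow_succ, mul_comm]; exact hhi'

/-- With `y = (4^(k+1) / x)^(1/4)`, the prefactor is `(8/3) / √x · y⁻²` and the exponential is `min
(y³) 1`. The product is at most a multiple of `min y (1/y)`, and `y` is geometric in `k`. Finally
`8/3 · 12 = 32`. -/
theorem sum_peelCoeff_le {x : ℝ} (hx : 0 < x) (n : ℕ) :
    ∑ k ∈ Finset.range n, peelCoeff x k ≤ 32 / √x := by
  have hq0 : 0 < √x := Real.sqrt_pos.2 hx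
  have hq2 : √x ^ 2 = x := Real.sq_sqrt hx.le
  have h2 : √(2 : ℝ) ^ 2 = 2 := Real.sq_sqrt (by norm_num)
  set z : ℝ := √(2 / √x) with hz
  have hz0 : 0 < z := Real.sqrt_pos.2 (by positivity)
  have hz2 : z ^ 2 = 2 / √x := Real.sq_sqrt (by positivity)
  have term : ∀ k, peelCoeff x k ≤
      8 / 3 / √x * min (z * √2 ^ k) (1 / (z * √2 ^ k)) := by
    intro k
    set y : ℝ := z * √2 ^ k with hy
    have hy0 : 0 < y := by positivity
    have hy2 : y ^ 2 = 2 / √x * 2 ^ k := by rw [hy, mul_pow, ← pow_mul, mul_comm k, pow_mul, h2, hz2]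
    have h4 : √((4 : ℝ) ^ k) = 2 ^ k := by
      rw [show (4 : ℝ) ^ k = (2 ^ k) ^ 2 by rw [← pow_mul, mul_comm, pow_mul]; norm_num]
      exact Real.sqrt_sq (by positivity)
    have hinv : (4 : ℝ) / 3 / 2 ^ k = 8 / 3 / √x * (1 / y ^ 2) := by
      rw [hy2]; field_simp; norm_num
    have hexp : Real.exp (-(3 / 4 * √(max (Real.log (x / 4 ^ (k + 1))) 0) ^ 2)) ≤
        min (y ^ 3) y := by
      rw [Real.sq_sqrt (le_max_right _ _)]
      have h44 : x / 4 ^ (k + 1) = (y ^ 4)⁻¹ := by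
        rw [show y ^ 4 = (y ^ 2) ^ 2 by ring, hy2, mul_pow, div_pow, hq2,
          show (4 : ℝ) ^ (k + 1) = 4 * (2 ^ k) ^ 2 by
            rw [← pow_mul, mul_comm k, pow_mul, pow_succ]; norm_num; ring]
        field_simp
        norm_num
      rw [h44, Real.log_inv, Real.log_pow]
      rcases le_or_gt y 1 with h | h
      · have hl : Real.log y ≤ 0 := Real.log_nonpos hy0.le h
        rw [max_eq_left (by push_cast; linarith)]
        have : Real.exp (-(3 / 4 * -(((4 : ℕ) : ℝ) * Real.log y))) = y ^ 3 := by
          rw [show -(3 / 4 * -(((4 : ℕ) : ℝ) * Real.log y)) = ((3 : ℕ) : ℝ) * Real.log y by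
            push_cast; ring, Real.exp_nat_mul, Real.exp_log hy0]
        rw [this]
        refine le_min le_rfl ?_
        have : y ^ 2 ≤ 1 := pow_le_one₀ hy0.le h
        nlinarith
      · refine (Real.exp_le_one_iff.2 ?_).trans (le_min (one_le_pow₀ h.le) h.le)
        exact neg_nonpos.2 (mul_nonneg (by norm_num) (le_max_right _ _))
    rw [peelCoeff, h4, hinv, mul_assoc]
    refine mul_le_mul_of_nonneg_left ?_ (by positivity)
    refine le_min ?_ ?_
    · calc _ ≤ 1 / y ^ 2 * y ^ 3 :=
          mul_le_mul_of_nonneg_left (hexp.trans (min_le_left _ _)) (by positivity)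
        _ = y := by field_simp
    · calc _ ≤ 1 / y ^ 2 * y :=
          mul_le_mul_of_nonneg_left (hexp.trans (min_le_right _ _)) (by positivity)
        _ = 1 / y := by field_simp
  calc _ ≤ ∑ k ∈ Finset.range n, 8 / 3 / √x * min (z * √2 ^ k) (1 / (z * √2 ^ k)) :=
        Finset.sum_le_sum fun k _ => term k
    _ ≤ 8 / 3 / √x * 12 := by
        rw [← Finset.mul_sum]
        exact mul_le_mul_of_nonneg_left (sum_min_geom_le hz0 n) (by positivity)
    _ = 32 / √x := by ring

/-! ### Pulls and deviations along a path -/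

/-- The sum of the deviations from `m` of the rewards of arm `a` in the rounds `s, …, t - 1`. -/
def deviation (A : ℕ → ℕ) (Y : ℕ → ℝ) (m : ℝ) (s t a : ℕ) : ℝ :=
  ∑ r ∈ (Finset.Ico s t).filter (fun r => A r = a), (Y r - m)

theorem pulls_succ (A : ℕ → ℕ) {s t : ℕ} (h : s ≤ t) (a : ℕ) :
    pulls A s (t + 1) a = pulls A s t a + if A t = a then 1 else 0 := by
  unfold pulls
  rw [← Finset.insert_Ico_right_eq_Ico_add_one h, Finset.filter_insert]
  split_ifs with ha
  · rw [Finset.card_insert_of_notMem (by simp)]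
  · rfl

theorem deviation_succ (A : ℕ → ℕ) (Y : ℕ → ℝ) (m : ℝ) {s t : ℕ} (h : s ≤ t) (a : ℕ) :
    deviation A Y m s (t + 1) a =
      deviation A Y m s t a + if A t = a then Y t - m else 0 := by
  unfold deviation
  rw [← Finset.insert_Ico_right_eq_Ico_add_one h, Finset.filter_insert]
  split_ifs with ha
  · rw [Finset.sum_insert (by simp), add_comm]
  · simp

@[simp] theorem pulls_self (A : ℕ → ℕ) (s a : ℕ) : pulls A s s a = 0 := by simp [pulls]

@[simp] theorem deviation_self (A : ℕ → ℕ) (Y : ℕ → ℝ) (m : ℝ) (s a : ℕ) :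
    deviation A Y m s s a = 0 := by simp [deviation]

theorem pulls_le (A : ℕ → ℕ) (s t a : ℕ) : pulls A s t a ≤ t - s :=
  (Finset.card_filter_le _ _).trans (by simp)

theorem deviation_eq_zero {A : ℕ → ℕ} {s t a : ℕ} (h : pulls A s t a = 0) (Y : ℕ → ℝ) (m : ℝ) :
    deviation A Y m s t a = 0 := by
  rw [pulls, Finset.card_eq_zero] at h
  rw [deviation, h, Finset.sum_empty]

theorem empiricalMean_eq {A : ℕ → ℕ} {s t a : ℕ} (h : pulls A s t a ≠ 0) (Y : ℕ → ℝ) (m : ℝ) :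
    empiricalMean A Y s t a = m + deviation A Y m s t a / pulls A s t a := by
  have h0 : (pulls A s t a : ℝ) ≠ 0 := by exact_mod_cast h
  have : deviation A Y m s t a =
      ∑ r ∈ (Finset.Ico s t).filter (fun r => A r = a), Y r - pulls A s t a * m := by
    rw [deviation, Finset.sum_sub_distrib, Finset.sum_const, nsmul_eq_mul]; rfl
  rw [empiricalMean, this]
  field_simp
  ring

/-- Summing over rounds a function of the number of previous pulls of the arm pulled. -/
theorem sum_pulls_eq {A : ℕ → ℕ} {s e K : ℕ} (hse : s ≤ e) (hA : ∀ t ∈ Finset.Ico s e, A t < K)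
    (φ : ℕ → ℝ) :
    ∑ t ∈ Finset.Ico s e, φ (pulls A s t (A t)) =
      ∑ a ∈ Finset.range K, ∑ k ∈ Finset.range (pulls A s e a), φ k := by
  induction e, hse using Nat.le_induction with
  | base => simp
  | succ e hse ih =>
    rw [Finset.sum_Ico_succ_top hse, ih fun t ht => hA t (by simp at ht ⊢; omega)]
    have hAe : A e ∈ Finset.range K := Finset.mem_range.2 (hA e (by simp; omega))
    rw [← Finset.add_sum_erase _ _ hAe, ← Finset.add_sum_erase _ _ hAe, pulls_succ A hse,
      if_pos rfl, Finset.sum_range_succ, add_right_comm]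
    congr 1
    refine Finset.sum_congr rfl fun a ha => ?_
    rw [pulls_succ A hse, if_neg (Finset.ne_of_mem_erase ha).symm, add_zero]

theorem sum_pulls_le {A : ℕ → ℕ} {s e K : ℕ} (hse : s ≤ e) (hA : ∀ t ∈ Finset.Ico s e, A t < K)
    (φ : ℕ → ℝ) {c : ℝ} (hφ : ∀ M, ∑ k ∈ Finset.range M, φ k ≤ c) :
    ∑ t ∈ Finset.Ico s e, φ (pulls A s t (A t)) ≤ K * c := by
  rw [sum_pulls_eq hse hA]
  refine (Finset.sum_le_card_nsmul _ _ c fun a _ => hφ _).trans ?_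
  simp

/-- One-round regret bound against arm `b`, from the maximality of the MOSS index. -/
theorem moss_round_le {n K : ℕ} {A : ℕ → ℕ} {Y : ℕ → ℝ} {s t : ℕ}
    (h : IsMossChoice n K A Y s t) {b : ℕ} (hb : b < K) {μ : ℕ → ℝ}
    (hμ : ∀ a < K, μ a ∈ Set.Icc (0 : ℝ) 1) {d : ℝ} (hd : 0 < d) :
    μ b - μ (A t) ≤ (if pulls A s t (A t) = 0 then 1 else 0)
      + max (-(deviation A Y (μ b) s t b / pulls A s t b) - width (n / K) (pulls A s t b)) 0
      + width (n / K) (pulls A s t (A t))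
      + max (deviation A Y (μ (A t)) s t (A t) / pulls A s t (A t) - d) 0 + d := by
  have h1 := le_max_right
    (-(deviation A Y (μ b) s t b / pulls A s t b) - width (n / K) (pulls A s t b)) 0
  have h2 := le_max_right (deviation A Y (μ (A t)) s t (A t) / pulls A s t (A t) - d) 0
  have h3 := width_nonneg (n / K) (pulls A s t (A t))
  have hmb := hμ b hb
  have hma := hμ _ h.1
  by_cases h0 : pulls A s t (A t) = 0
  · rw [if_pos h0]
    linarith [hmb.2, hma.1]
  · rw [if_neg h0]
    have hidx := h.2 b hb
    -- An unpulled `b` would have index `⊤`, above the finite index of the arm chosen.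
    have hb0 : pulls A s t b ≠ 0 := by
      intro hb0
      rw [mossIndex, if_pos hb0, mossIndex, if_neg h0] at hidx
      exact absurd hidx (not_le.2 (EReal.coe_lt_top _))
    rw [mossIndex, if_neg hb0, mossIndex, if_neg h0, EReal.coe_le_coe_iff,
      empiricalMean_eq hb0 Y (μ b), empiricalMean_eq h0 Y (μ (A t)), ← div_div, ← div_div] at hidx
    have h4 := le_max_left
      (-(deviation A Y (μ b) s t b / pulls A s t b) - width (n / K) (pulls A s t b)) 0
    have h5 := le_max_left (deviation A Y (μ (A t)) s t (A t) / pulls A s t (A t) - d) 0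
    simp only [width] at *
    linarith

/-- The exponential process attached to the deviations of arm `a`. -/
def expProcess (A : ℕ → ℕ) (Y : ℕ → ℝ) (m l : ℝ) (s t a : ℕ) : ℝ :=
  Real.exp (l * deviation A Y m s t a - l ^ 2 / 4 * pulls A s t a)

theorem expProcess_nonneg (A : ℕ → ℕ) (Y : ℕ → ℝ) (m l : ℝ) (s t a : ℕ) :
    0 ≤ expProcess A Y m l s t a := (Real.exp_pos _).le

/-- The one-step factor is written with a coefficient that is `l` or `0` according to the arm
pulled. This coefficient is known before the reward, so one subgaussian bound covers both cases. -/
theorem expProcess_succ (A : ℕ → ℕ) (Y : ℕ → ℝ) (μ : ℕ → ℝ) (l : ℝ) {s t : ℕ} (h : s ≤ t)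
    (a : ℕ) :
    expProcess A Y (μ a) l s (t + 1) a = expProcess A Y (μ a) l s t a *
      Real.exp ((if A t = a then l else 0) * (Y t - μ (A t)) - (if A t = a then l else 0) ^ 2 / 4) := by
  rw [expProcess, expProcess, ← Real.exp_add, deviation_succ A Y _ h, pulls_succ A h]
  congr 1
  split_ifs with ha
  · rw [ha]; push_cast; ring
  · simp

theorem shortfall_le_sum_expProcess {x : ℝ} (hx : 0 < x) (A : ℕ → ℕ) (Y : ℕ → ℝ) (m : ℝ)
    {s t n : ℕ} (hn : t - s ≤ n) (b : ℕ) :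
    max (-(deviation A Y m s t b / pulls A s t b) - width x (pulls A s t b)) 0 ≤
      ∑ k ∈ Finset.range n, peelCoeff x k * expProcess A Y m (peelRate x k) s t b := by
  -- Without pulls both the quotient and the width are zero by the convention for division by zero,
  -- so the left side vanishes.
  rcases Nat.eq_zero_or_pos (pulls A s t b) with h | h
  · rw [h, deviation_eq_zero h]
    refine le_trans ?_ (Finset.sum_nonneg fun k _ =>
      mul_nonneg (peelCoeff_nonneg x k) (expProcess_nonneg ..))
    simp [width]
  · exact shortfall_le_sum hx h ((pulls_le A s t b).trans hn) _

/-- The process `expProcess` at the round where arm `a` is pulled for the `k + 1`-st time. -/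
def pulledExpProcess (A : ℕ → ℕ) (Y : ℕ → ℝ) (m l : ℝ) (s t a k : ℕ) : ℝ :=
  if A t = a ∧ pulls A s t a = k then expProcess A Y m l s t a else 0

theorem pulledExpProcess_nonneg (A : ℕ → ℕ) (Y : ℕ → ℝ) (m l : ℝ) (s t a k : ℕ) :
    0 ≤ pulledExpProcess A Y m l s t a k := by
  unfold pulledExpProcess
  split_ifs
  · exact expProcess_nonneg ..
  · exact le_rfl

theorem excess_le_sum_pulledExpProcess {d : ℝ} (hd : 0 < d) (A : ℕ → ℕ) (Y : ℕ → ℝ) (μ : ℕ → ℝ)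
    {s t n K : ℕ} (hn : t - s < n) (hA : A t < K) :
    max (deviation A Y (μ (A t)) s t (A t) / pulls A s t (A t) - d) 0 ≤
      ∑ a ∈ Finset.range K, ∑ k ∈ Finset.range n,
        Real.exp (-(k * d ^ 2)) / (2 * √(k : ℝ)) *
          pulledExpProcess A Y (μ a) (2 * d + 2 / √(k : ℝ)) s t a k := by
  have hnn : ∀ a k : ℕ, 0 ≤ Real.exp (-(k * d ^ 2)) / (2 * √(k : ℝ)) *
      pulledExpProcess A Y (μ a) (2 * d + 2 / √(k : ℝ)) s t a k := fun a k =>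
    mul_nonneg (by positivity) (pulledExpProcess_nonneg ..)
  have h1 : pulls A s t (A t) ∈ Finset.range n :=
    Finset.mem_range.2 ((pulls_le A s t _).trans_lt hn)
  refine le_trans ?_ (Finset.single_le_sum (f := fun a => ∑ k ∈ Finset.range n,
    Real.exp (-(k * d ^ 2)) / (2 * √(k : ℝ)) *
      pulledExpProcess A Y (μ a) (2 * d + 2 / √(k : ℝ)) s t a k)
    (fun a _ => Finset.sum_nonneg fun k _ => hnn a k) (Finset.mem_range.2 hA))
  refine le_trans ?_ (Finset.single_le_sum (f := fun k : ℕ =>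
    Real.exp (-(k * d ^ 2)) / (2 * √(k : ℝ)) *
      pulledExpProcess A Y (μ (A t)) (2 * d + 2 / √(k : ℝ)) s t (A t) k)
    (fun k _ => hnn _ k) h1)
  rcases Nat.eq_zero_or_pos (pulls A s t (A t)) with h | h
  · refine le_trans (le_of_eq ?_) (hnn _ _)
    rw [h, deviation_eq_zero h]
    simp [hd.le]
  · refine (excess_le_exp h hd _).trans (le_of_eq ?_)
    simp [pulledExpProcess, expProcess]

/-- Regret of MOSS along a path. -/
theorem moss_path_le {n K : ℕ} (hK : 0 < K) (hn : 0 < n) {A : ℕ → ℕ} {Y : ℕ → ℝ} {s e : ℕ}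
    (hse : s ≤ e) (he : e ≤ s + n) (h : ∀ t ∈ Finset.Ico s e, IsMossChoice n K A Y s t)
    {b : ℕ} (hb : b < K) {μ : ℕ → ℝ} (hμ : ∀ a < K, μ a ∈ Set.Icc (0 : ℝ) 1)
    {d : ℝ} (hd : 0 < d) :
    ∑ t ∈ Finset.Ico s e, (μ b - μ (A t)) ≤
      (K + K * (4 * √(n / K)) + n * d)
      + ∑ t ∈ Finset.Ico s e, ∑ k ∈ Finset.range n,
          peelCoeff (n / K) k * expProcess A Y (μ b) (peelRate (n / K) k) s t b
      + ∑ a ∈ Finset.range K, ∑ k ∈ Finset.range n, Real.exp (-(k * d ^ 2)) / (2 * √(k : ℝ)) *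
          ∑ t ∈ Finset.Ico s e, pulledExpProcess A Y (μ a) (2 * d + 2 / √(k : ℝ)) s t a k := by
  have hx : (0 : ℝ) < n / K := by positivity
  have hAK : ∀ t ∈ Finset.Ico s e, A t < K := fun t ht => (h t ht).1
  have h1 : ∑ t ∈ Finset.Ico s e, (if pulls A s t (A t) = 0 then (1 : ℝ) else 0) ≤ K := by
    have := sum_pulls_le hse hAK (fun k => if k = 0 then (1 : ℝ) else 0) (c := 1) fun M => by
      rw [Finset.sum_ite_eq']; split_ifs <;> norm_num
    simpa using this
  have h2 := sum_pulls_le hse hAK (width (n / K)) (sum_width_le hx)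
  have h3 : ∑ _t ∈ Finset.Ico s e, d ≤ n * d := by
    rw [Finset.sum_const, Nat.card_Ico, nsmul_eq_mul]
    have : ((e - s : ℕ) : ℝ) ≤ n := by exact_mod_cast (by omega : e - s ≤ n)
    gcongr
  have h4 : ∑ t ∈ Finset.Ico s e,
      max (deviation A Y (μ (A t)) s t (A t) / pulls A s t (A t) - d) 0 ≤
      ∑ a ∈ Finset.range K, ∑ k ∈ Finset.range n, Real.exp (-(k * d ^ 2)) / (2 * √(k : ℝ)) *
          ∑ t ∈ Finset.Ico s e, pulledExpProcess A Y (μ a) (2 * d + 2 / √(k : ℝ)) s t a k := by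
    refine (Finset.sum_le_sum fun t ht => excess_le_sum_pulledExpProcess hd A Y μ
      (n := n) (by simp at ht; omega) (hAK t ht)).trans (le_of_eq ?_)
    rw [Finset.sum_comm]
    refine Finset.sum_congr rfl fun a _ => ?_
    rw [Finset.sum_comm]
    refine Finset.sum_congr rfl fun k _ => ?_
    rw [Finset.mul_sum]
  have h5 := Finset.sum_le_sum (s := Finset.Ico s e) fun t ht =>
    moss_round_le (h t ht) hb hμ hd
  have h6 := Finset.sum_le_sum (s := Finset.Ico s e) fun t ht =>
    shortfall_le_sum_expProcess hx A Y (μ b) (n := n) (by simp at ht; omega : t - s ≤ n) b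
  simp only [Finset.sum_add_distrib] at h5
  linarith

/-! ### MOSS against subgaussian rewards -/

/-- In the rounds `s, …, e - 1`, given the information `𝓕 t` available when arm `A t` has been
chosen, the reward `Y t` is `1/2`-subgaussian around the mean `μ (A t)` of the arm. The means may
be random, provided they are known at the beginning. -/
structure IsSubgaussianFeedback {Ω : Type*} [mΩ : MeasurableSpace Ω] (P : Measure Ω)
    (𝓕 : ℕ → MeasurableSpace Ω) (s e : ℕ) (A : ℕ → Ω → ℕ) (Y : ℕ → Ω → ℝ) (μ : ℕ → Ω → ℝ) :
    Prop where
  le : ∀ t, 𝓕 t ≤ mΩ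
  measurable_arm : ∀ t, ∀ r ≤ t, Measurable[𝓕 t] (A r)
  measurable_past : ∀ t, ∀ r < t, Measurable[𝓕 t] (Y r)
  measurable_mean : ∀ t, s ≤ t → ∀ a, Measurable[𝓕 t] (μ a)
  lintegral_exp_le : ∀ t ∈ Finset.Ico s e, ∀ (c : Ω → ℝ) (G : Ω → ℝ≥0∞),
    Measurable[𝓕 t] c → Measurable[𝓕 t] G →
      ∫⁻ ω, G ω * ENNReal.ofReal (Real.exp (c ω * (Y t ω - μ (A t ω) ω) - c ω ^ 2 / 4)) ∂P ≤
        ∫⁻ ω, G ω ∂P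

theorem measurable_pulls {Ω : Type*} {m : MeasurableSpace Ω} {A : ℕ → Ω → ℕ} {s t : ℕ}
    (hA : ∀ r < t, Measurable (A r)) (a : ℕ) :
    Measurable fun ω => pulls (fun r => A r ω) s t a := by
  simp only [pulls, Finset.card_filter]
  refine Finset.measurable_sum _ fun r hr => ?_
  exact Measurable.ite (hA r (by simp at hr; omega) (measurableSet_singleton a))
    measurable_const measurable_const

theorem measurable_deviation {Ω : Type*} {m : MeasurableSpace Ω} {A : ℕ → Ω → ℕ} {Y : ℕ → Ω → ℝ}
    {μ : Ω → ℝ} {s t : ℕ} (hA : ∀ r < t, Measurable (A r)) (hY : ∀ r < t, Measurable (Y r))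
    (hμ : Measurable μ) (a : ℕ) :
    Measurable fun ω => deviation (fun r => A r ω) (fun r => Y r ω) (μ ω) s t a := by
  simp only [deviation, Finset.sum_filter]
  refine Finset.measurable_sum _ fun r hr => ?_
  have hr : r < t := by simp at hr; omega
  exact Measurable.ite (hA r hr (measurableSet_singleton a)) ((hY r hr).sub hμ) measurable_const

theorem measurable_expProcess {Ω : Type*} {m : MeasurableSpace Ω} {A : ℕ → Ω → ℕ}
    {Y : ℕ → Ω → ℝ} {μ : Ω → ℝ} {s t : ℕ} (hA : ∀ r < t, Measurable (A r))
    (hY : ∀ r < t, Measurable (Y r)) (hμ : Measurable μ) (l : ℝ) (a : ℕ) :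
    Measurable fun ω => expProcess (fun r => A r ω) (fun r => Y r ω) (μ ω) l s t a := by
  unfold expProcess
  have h1 := measurable_deviation (s := s) hA hY hμ a
  have h2 : Measurable fun ω => (pulls (fun r => A r ω) s t a : ℝ) :=
    measurable_from_top.comp (measurable_pulls (s := s) hA a)
  exact Real.measurable_exp.comp ((h1.const_mul l).sub (h2.const_mul _))

theorem integrable_and_integral_le {Ω : Type*} [MeasurableSpace Ω] {P : Measure Ω} {g : Ω → ℝ}
    (hg : Measurable g) (h0 : ∀ ω, 0 ≤ g ω) {c : ℝ} (hc : 0 ≤ c)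
    (h : ∫⁻ ω, ENNReal.ofReal (g ω) ∂P ≤ ENNReal.ofReal c) :
    Integrable g P ∧ ∫ ω, g ω ∂P ≤ c := by
  constructor
  · exact (lintegral_ofReal_ne_top_iff_integrable hg.aestronglyMeasurable
      (Filter.Eventually.of_forall h0)).1 (h.trans_lt ENNReal.ofReal_lt_top).ne
  · rw [integral_eq_lintegral_of_nonneg_ae (Filter.Eventually.of_forall h0)
      hg.aestronglyMeasurable]
    exact ENNReal.toReal_le_of_le_ofReal hc h

namespace IsSubgaussianFeedback

variable {Ω : Type*} [mΩ : MeasurableSpace Ω] {P : Measure Ω}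
  {𝓕 : ℕ → MeasurableSpace Ω} {s e : ℕ} {A : ℕ → Ω → ℕ} {Y : ℕ → Ω → ℝ} {μ : ℕ → Ω → ℝ}

theorem measurable_exp_process (h : IsSubgaussianFeedback P 𝓕 s e A Y μ) (l : ℝ) (a : ℕ) {t : ℕ}
    (hst : s ≤ t) : Measurable[𝓕 t] fun ω =>
      expProcess (fun r => A r ω) (fun r => Y r ω) (μ a ω) l s t a :=
  measurable_expProcess (m := 𝓕 t) (fun r hr => h.measurable_arm t r hr.le) (h.measurable_past t)
    (h.measurable_mean t hst a) l a

theorem measurableSet_arm (h : IsSubgaussianFeedback P 𝓕 s e A Y μ) (t a : ℕ) :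
    MeasurableSet[𝓕 t] {ω | A t ω = a} :=
  h.measurable_arm t t le_rfl (measurableSet_singleton a)

theorem measurableSet_pulls (h : IsSubgaussianFeedback P 𝓕 s e A Y μ) (t a : ℕ) (B : Set ℕ) :
    MeasurableSet[𝓕 t] {ω | pulls (fun r => A r ω) s t a ∈ B} :=
  measurable_pulls (m := 𝓕 t) (fun r hr => h.measurable_arm t r hr.le) a (MeasurableSet.of_discrete)

/-- The supermartingale property, in terms of `∫⁻`: the past value of the process serves as the
weight `G`, so neither integrability nor conditional expectations are needed. -/
theorem lintegral_expProcess_le [IsProbabilityMeasure P] (h : IsSubgaussianFeedback P 𝓕 s e A Y μ) (l : ℝ) (a : ℕ) {t : ℕ}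
    (hst : s ≤ t) (hte : t ≤ e) :
    ∫⁻ ω, ENNReal.ofReal (expProcess (fun r => A r ω) (fun r => Y r ω) (μ a ω) l s t a) ∂P ≤ 1 := by
  induction t, hst using Nat.le_induction with
  | base => simp [expProcess]
  | succ t hst ih =>
    refine le_trans ?_ (ih (by omega))
    have := h.lintegral_exp_le t (by simp; omega) (fun ω => if A t ω = a then l else 0)
      (fun ω => ENNReal.ofReal
        (expProcess (fun r => A r ω) (fun r => Y r ω) (μ a ω) l s t a))
      (Measurable.ite (h.measurableSet_arm t a) measurable_const measurable_const)
      (ENNReal.measurable_ofReal.comp (h.measurable_exp_process l a hst))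
    refine le_trans (le_of_eq ?_) this
    refine lintegral_congr fun ω => ?_
    rw [← ENNReal.ofReal_mul (expProcess_nonneg ..),
      expProcess_succ _ _ (fun a => μ a ω) l hst a]

/-- Optional stopping at the `k + 1`-st pull of `a`. The first integral collects the mass already
stopped, the second the mass still running. Each round moves the event `S` from the second to the
first, and the rest does not grow because `U \ S` is known before the reward. -/
theorem lintegral_pulled_le [IsProbabilityMeasure P] (h : IsSubgaussianFeedback P 𝓕 s e A Y μ) (l : ℝ) (a k : ℕ)
    {t : ℕ} (hst : s ≤ t) (hte : t ≤ e) :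
    ∫⁻ ω, ∑ r ∈ Finset.Ico s t, ENNReal.ofReal
        (pulledExpProcess (fun r => A r ω) (fun r => Y r ω) (μ a ω) l s r a k) ∂P +
      ∫⁻ ω, {ω | pulls (fun r => A r ω) s t a ≤ k}.indicator (fun ω => ENNReal.ofReal
        (expProcess (fun r => A r ω) (fun r => Y r ω) (μ a ω) l s t a)) ω ∂P ≤ 1 := by
  induction t, hst using Nat.le_induction with
  | base => simp [expProcess]
  | succ t hst ih =>
    refine le_trans ?_ (ih (by omega))
    set M : Ω → ℝ≥0∞ := fun ω => ENNReal.ofReal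
      (expProcess (fun r => A r ω) (fun r => Y r ω) (μ a ω) l s t a) with hM
    set S : Set Ω := {ω | A t ω = a ∧ pulls (fun r => A r ω) s t a = k} with hS
    set U : Set Ω := {ω | pulls (fun r => A r ω) s t a ≤ k} with hU
    have hSm : MeasurableSet[𝓕 t] S :=
      (h.measurableSet_arm t a).inter (h.measurableSet_pulls t a {k})
    have hUm : MeasurableSet[𝓕 t] U := h.measurableSet_pulls t a (Set.Iic k)
    have hMm : Measurable[𝓕 t] M :=
      ENNReal.measurable_ofReal.comp (h.measurable_exp_process l a hst)
    have hsplit : ∫⁻ ω, U.indicator M ω ∂P =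
        ∫⁻ ω, S.indicator M ω ∂P + ∫⁻ ω, (U \ S).indicator M ω ∂P := by
      rw [← lintegral_add_left ((hMm.indicator hSm).mono (h.le t) le_rfl)]
      refine lintegral_congr fun ω => ?_
      by_cases h1 : ω ∈ S
      · have h2 : ω ∈ U := h1.2.le
        simp [h1, h2]
      · by_cases h2 : ω ∈ U <;> simp [h1, h2]
    have hlast : ∫⁻ ω, {ω | pulls (fun r => A r ω) s (t + 1) a ≤ k}.indicator
        (fun ω => ENNReal.ofReal
          (expProcess (fun r => A r ω) (fun r => Y r ω) (μ a ω) l s (t + 1) a)) ω ∂P ≤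
        ∫⁻ ω, (U \ S).indicator M ω ∂P := by
      refine le_trans (le_of_eq ?_) (h.lintegral_exp_le t (by simp; omega)
        (fun ω => if A t ω = a then l else 0) ((U \ S).indicator M)
        (Measurable.ite (h.measurableSet_arm t a) measurable_const measurable_const)
        (hMm.indicator (hUm.diff hSm)))
      refine lintegral_congr fun ω => ?_
      have hiff : pulls (fun r => A r ω) s (t + 1) a ≤ k ↔ ω ∈ U \ S := by
        rw [pulls_succ _ hst]
        simp only [hU, hS, Set.mem_sdiff, Set.mem_ofPred_eq]
        split_ifs with ha
        · simp only [ha, true_and]; omega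
        · simp [ha]
      set V : Set Ω := {ω | pulls (fun r => A r ω) s (t + 1) a ≤ k}
      have hiff : ω ∈ V ↔ ω ∈ U \ S := hiff
      by_cases h1 : ω ∈ U \ S
      · rw [Set.indicator_of_mem h1, Set.indicator_of_mem (hiff.2 h1), hM,
          ← ENNReal.ofReal_mul (expProcess_nonneg ..),
          expProcess_succ _ _ (fun a => μ a ω) l hst a]
      · rw [Set.indicator_of_notMem h1, Set.indicator_of_notMem (fun h2 => h1 (hiff.1 h2)), zero_mul]
    have hnew : ∀ ω, ENNReal.ofReal
        (pulledExpProcess (fun r => A r ω) (fun r => Y r ω) (μ a ω) l s t a k) =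
          S.indicator M ω := by
      intro ω
      by_cases h1 : ω ∈ S
      · rw [Set.indicator_of_mem h1, pulledExpProcess,
          if_pos (show A t ω = a ∧ pulls (fun r => A r ω) s t a = k from h1)]
      · rw [Set.indicator_of_notMem h1, pulledExpProcess,
          if_neg (show ¬(A t ω = a ∧ pulls (fun r => A r ω) s t a = k) from h1), ENNReal.ofReal_zero]
    rw [hsplit, ← add_assoc]
    refine add_le_add (le_of_eq ?_) hlast
    simp only [Finset.sum_Ico_succ_top hst, hnew]
    rw [lintegral_add_right _ ((hMm.indicator hSm).mono (h.le t) le_rfl)]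

theorem expProcess_integral [IsProbabilityMeasure P] (h : IsSubgaussianFeedback P 𝓕 s e A Y μ) (l : ℝ) (a : ℕ) {t : ℕ}
    (hst : s ≤ t) (hte : t ≤ e) :
    Integrable (fun ω => expProcess (fun r => A r ω) (fun r => Y r ω) (μ a ω) l s t a) P ∧
    ∫ ω, expProcess (fun r => A r ω) (fun r => Y r ω) (μ a ω) l s t a ∂P ≤ 1 :=
  integrable_and_integral_le ((h.measurable_exp_process l a hst).mono (h.le t) le_rfl)
    (fun _ => expProcess_nonneg ..) zero_le_one
    ((h.lintegral_expProcess_le l a hst hte).trans (by simp))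

theorem pulledExpProcess_integral [IsProbabilityMeasure P] (h : IsSubgaussianFeedback P 𝓕 s e A Y μ) (l : ℝ) (a k : ℕ)
    (hse : s ≤ e) :
    Integrable (fun ω => ∑ t ∈ Finset.Ico s e,
      pulledExpProcess (fun r => A r ω) (fun r => Y r ω) (μ a ω) l s t a k) P ∧
    ∫ ω, ∑ t ∈ Finset.Ico s e,
      pulledExpProcess (fun r => A r ω) (fun r => Y r ω) (μ a ω) l s t a k ∂P ≤ 1 := by
  refine integrable_and_integral_le (Finset.measurable_sum _ fun t ht => ?_)
    (fun _ => Finset.sum_nonneg fun _ _ => pulledExpProcess_nonneg ..) zero_le_one ?_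
  · have hst : s ≤ t := by simp at ht; omega
    exact (Measurable.ite ((h.measurableSet_arm t a).inter (h.measurableSet_pulls t a {k}))
      (h.measurable_exp_process l a hst) measurable_const).mono (h.le t) le_rfl
  · refine le_trans ?_ ((self_le_add_right _ _).trans
      ((h.lintegral_pulled_le l a k hse le_rfl).trans (by simp)))
    refine le_of_eq (lintegral_congr fun ω => ?_)
    rw [ENNReal.ofReal_sum_of_nonneg fun _ _ => pulledExpProcess_nonneg ..]

/-- **Distribution-free regret bound for MOSS**, against a fixed arm `b`. -/
theorem moss_regret_le [IsProbabilityMeasure P] (h : IsSubgaussianFeedback P 𝓕 s e A Y μ) {n K : ℕ} (hK : 0 < K)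
    (hKn : K ≤ n) (hse : s ≤ e) (he : e ≤ s + n)
    (hmoss : ∀ t ∈ Finset.Ico s e, ∀ᵐ ω ∂P,
      IsMossChoice n K (fun r => A r ω) (fun r => Y r ω) s t)
    (hμ : ∀ a < K, ∀ ω, μ a ω ∈ Set.Icc (0 : ℝ) 1) {b : ℕ} (hb : b < K) :
    ∫ ω, ∑ t ∈ Finset.Ico s e, (μ b ω - μ (A t ω) ω) ∂P ≤ 40 * √(K * n) := by
  have hn : 0 < n := hK.trans_le hKn
  have hK0 : (0 : ℝ) < K := by exact_mod_cast hK
  have hn0 : (0 : ℝ) < n := by exact_mod_cast hn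
  have hKn' : (K : ℝ) ≤ n := by exact_mod_cast hKn
  set x : ℝ := n / K with hxdef
  have hx : 0 < x := by positivity
  have hsx : 0 < √x := Real.sqrt_pos.2 hx
  -- This threshold gives `n d = K √x = √(K n)`, so all the error terms have the same order.
  set d : ℝ := 1 / √x with hddef
  have hd : 0 < d := by positivity
  set R : Ω → ℝ := fun ω => (K + K * (4 * √x) + n * d)
      + ∑ t ∈ Finset.Ico s e, ∑ k ∈ Finset.range n,
          peelCoeff x k * expProcess (fun r => A r ω) (fun r => Y r ω) (μ b ω) (peelRate x k) s t b
      + ∑ a ∈ Finset.range K, ∑ k ∈ Finset.range n, Real.exp (-(k * d ^ 2)) / (2 * √(k : ℝ)) *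
          ∑ t ∈ Finset.Ico s e, pulledExpProcess (fun r => A r ω) (fun r => Y r ω) (μ a ω)
            (2 * d + 2 / √(k : ℝ)) s t a k with hR
  have hi1 : ∀ t ∈ Finset.Ico s e, ∀ k ∈ Finset.range n, Integrable (fun ω => peelCoeff x k *
      expProcess (fun r => A r ω) (fun r => Y r ω) (μ b ω) (peelRate x k) s t b) P :=
    fun t ht k _ => ((h.expProcess_integral _ b (by simp at ht; omega)
      (by simp at ht; omega)).1).const_mul _
  have hi2 : ∀ a ∈ Finset.range K, ∀ k ∈ Finset.range n, Integrable (fun ω =>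
      Real.exp (-(k * d ^ 2)) / (2 * √(k : ℝ)) *
          ∑ t ∈ Finset.Ico s e, pulledExpProcess (fun r => A r ω) (fun r => Y r ω) (μ a ω)
            (2 * d + 2 / √(k : ℝ)) s t a k) P :=
    fun a _ k _ => ((h.pulledExpProcess_integral _ a k hse).1).const_mul _
  have hI1 := integrable_finsetSum _ fun t ht => integrable_finsetSum _ (hi1 t ht)
  have hI2 := integrable_finsetSum _ fun a ha => integrable_finsetSum _ (hi2 a ha)
  have hKx : K * √x = √(K * n) := by
    rw [hxdef, Real.sqrt_div hn0.le, Real.sqrt_mul hK0.le]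
    have := Real.sq_sqrt hK0.le
    have h0 : 0 < √(K : ℝ) := Real.sqrt_pos.2 hK0
    rw [mul_div_assoc', div_eq_iff h0.ne']
    linear_combination (-√(n : ℝ)) * this
  have hnx : n / √x = √(K * n) := by
    rw [← hKx, div_eq_iff hsx.ne', mul_assoc, Real.mul_self_sqrt hx.le, hxdef]
    field_simp
  have hKle : (K : ℝ) ≤ √(K * n) := by
    apply Real.le_sqrt_of_sq_le; nlinarith
  have hsum1 : ∫ ω, ∑ t ∈ Finset.Ico s e, ∑ k ∈ Finset.range n, peelCoeff x k *
      expProcess (fun r => A r ω) (fun r => Y r ω) (μ b ω) (peelRate x k) s t b ∂P ≤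
        n * (32 / √x) := by
    rw [integral_finsetSum _ fun t ht => integrable_finsetSum _ (hi1 t ht)]
    calc _ ≤ ∑ _t ∈ Finset.Ico s e, 32 / √x := by
          refine Finset.sum_le_sum fun t ht => ?_
          rw [integral_finsetSum _ (hi1 t ht)]
          refine le_trans (Finset.sum_le_sum fun k _ => ?_) (sum_peelCoeff_le hx n)
          rw [integral_const_mul]
          exact mul_le_of_le_one_right (peelCoeff_nonneg x k)
            (h.expProcess_integral _ b (by simp at ht; omega) (by simp at ht; omega)).2
      _ ≤ n * (32 / √x) := by
          rw [Finset.sum_const, Nat.card_Ico, nsmul_eq_mul]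
          have : ((e - s : ℕ) : ℝ) ≤ n := by exact_mod_cast (by omega : e - s ≤ n)
          gcongr
  have hsum2 : ∫ ω, ∑ a ∈ Finset.range K, ∑ k ∈ Finset.range n,
      Real.exp (-(k * d ^ 2)) / (2 * √(k : ℝ)) *
          ∑ t ∈ Finset.Ico s e, pulledExpProcess (fun r => A r ω) (fun r => Y r ω) (μ a ω)
            (2 * d + 2 / √(k : ℝ)) s t a k ∂P ≤ K * (2 * √x) := by
    rw [integral_finsetSum _ fun a ha => integrable_finsetSum _ (hi2 a ha)]
    calc _ ≤ ∑ _a ∈ Finset.range K, 2 * √x := by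
          refine Finset.sum_le_sum fun a ha => ?_
          rw [integral_finsetSum _ (hi2 a ha)]
          refine le_trans (Finset.sum_le_sum fun k _ => ?_) (sum_exp_div_sqrt_le hx n)
          rw [integral_const_mul]
          exact mul_le_of_le_one_right (by positivity) (h.pulledExpProcess_integral _ a k hse).2
      _ = K * (2 * √x) := by simp
  have hRint : Integrable R P := ((integrable_const _).add hI1).add hI2
  have hRle : ∫ ω, R ω ∂P ≤ 40 * √(K * n) := by
    have e3 := integral_add ((integrable_const (K + K * (4 * √x) + n * d)).add hI1) hI2
    have e4 := integral_add (integrable_const (μ := P) (K + K * (4 * √x) + n * d)) hI1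
    refine (e3.trans (congrArg₂ (· + ·) e4 rfl)).trans_le ?_
    simp only [integral_const, probReal_univ, smul_eq_mul, one_mul]
    have e1 : (n : ℝ) * d = √(K * n) := by rw [← hnx, hddef]; ring
    have e2 : (n : ℝ) * (32 / √x) = 32 * √(K * n) := by rw [← hnx]; ring
    rw [e1]
    -- First pulls, widths, threshold, shortfall and excess contribute `1 + 4 + 1 + 32 + 2 = 40`.
    linarith
  have hle : ∀ᵐ ω ∂P, ∑ t ∈ Finset.Ico s e, (μ b ω - μ (A t ω) ω) ≤ R ω := by
    filter_upwards [(Finset.eventually_all _).2 hmoss] with ω hω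
    exact moss_path_le hK hn hse he hω hb (fun a ha => hμ a ha ω) hd
  by_cases hint : Integrable (fun ω => ∑ t ∈ Finset.Ico s e, (μ b ω - μ (A t ω) ω)) P
  · exact (integral_mono_ae hint hRint hle).trans hRle
  -- A non-integrable function has integral `0` by convention.
  · rw [integral_undef hint]
    positivity

end IsSubgaussianFeedback

/-! ### The arms of MeDZO -/

theorem regimeEnd_succ (p i : ℕ) : regimeEnd p (i + 1) = regimeEnd p i + regimeLength p (i + 1) := by
  rw [regimeEnd, regimeEnd, Finset.sum_Icc_succ_top (by omega)]

theorem regimeEnd_mono (p : ℕ) : Monotone (regimeEnd p) :=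
  monotone_nat_of_le_succ fun i => by rw [regimeEnd_succ]; omega

theorem regimeEnd_eq {p i : ℕ} (hi : 1 ≤ i) :
    regimeEnd p i = regimeEnd p (i - 1) + regimeLength p i := by
  obtain ⟨k, rfl⟩ := Nat.exists_eq_add_of_le' hi
  exact regimeEnd_succ p k

theorem regimeLength_pos (p i : ℕ) : 0 < regimeLength p i := by unfold regimeLength; positivity

theorem numCells_pos (p i : ℕ) : 0 < numCells p i := by unfold numCells; positivity

theorem measurableSet_cell (K k : ℕ) :
    MeasurableSet {x : I | (k : ℝ) / K ≤ (x : ℝ) ∧ (x : ℝ) ≤ ((k : ℝ) + 1) / K} :=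
  (measurableSet_le measurable_const measurable_subtype_coe).inter
    (measurableSet_le measurable_subtype_coe measurable_const)

theorem isProbabilityMeasure_cellLaw {K k : ℕ} (hk : k < K) :
    IsProbabilityMeasure (cellLaw K k) := by
  have hK : (0 : ℝ) < K := by exact_mod_cast (by omega : 0 < K)
  have hkK : (k : ℝ) + 1 ≤ K := by exact_mod_cast hk
  have h1 : (k : ℝ) / K ∈ Set.Icc (0 : ℝ) 1 := ⟨by positivity, by rw [div_le_one hK]; linarith⟩
  have h2 : ((k : ℝ) + 1) / K ∈ Set.Icc (0 : ℝ) 1 := ⟨by positivity, by rwa [div_le_one hK]⟩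
  refine cond_isProbabilityMeasure ?_
  have : {x : I | (k : ℝ) / K ≤ (x : ℝ) ∧ (x : ℝ) ≤ ((k : ℝ) + 1) / K} =
      Set.Icc (⟨_, h1⟩ : I) ⟨_, h2⟩ := rfl
  rw [this, unitInterval.volume_Icc]
  simp only [ne_eq, ENNReal.ofReal_eq_zero, not_le]
  have : ((k : ℝ) + 1) / K - k / K = 1 / K := by ring
  rw [this]
  positivity

theorem exists_integral_cellLaw_ge {L α : ℝ} (hL : 0 < L) (hα : 0 < α) {f : I → ℝ}
    (hfm : Measurable f) (hf : ∀ x, f x ∈ Set.Icc (0 : ℝ) 1) {xstar : I}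
    (hx : ∀ x : I, |f xstar - f x| ≤ L * |(xstar : ℝ) - (x : ℝ)| ^ α) {K : ℕ} (hK : 0 < K) :
    ∃ k < K, f xstar - L * (1 / K : ℝ) ^ α ≤ ∫ x, f x ∂(cellLaw K k) := by
  have hK0 : (0 : ℝ) < K := by exact_mod_cast hK
  obtain ⟨k, hkK, h1, h2⟩ : ∃ k < K, (k : ℝ) / K ≤ xstar ∧ (xstar : ℝ) ≤ (k + 1) / K := by
    have hx0 := xstar.2.1
    have hx1 := xstar.2.2
    rcases eq_or_lt_of_le hx1 with h | h
    · refine ⟨K - 1, by omega, ?_, ?_⟩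
      · rw [h, div_le_one hK0]; exact_mod_cast Nat.sub_le K 1
      · rw [h, le_div_iff₀ hK0, Nat.cast_sub hK]; simp
    · refine ⟨⌊K * (xstar : ℝ)⌋₊, ?_, ?_, ?_⟩
      · rw [Nat.floor_lt (by positivity)]; nlinarith
      · rw [div_le_iff₀ hK0, mul_comm]; exact Nat.floor_le (by positivity)
      · rw [le_div_iff₀ hK0, mul_comm]; exact (Nat.lt_floor_add_one _).le
  refine ⟨k, hkK, ?_⟩
  have := isProbabilityMeasure_cellLaw hkK
  have hint : Integrable f (cellLaw K k) :=
    Integrable.of_mem_Icc 0 1 hfm.aemeasurable (Filter.Eventually.of_forall hf)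
  have : ∫ _x, (f xstar - L * (1 / K : ℝ) ^ α) ∂(cellLaw K k) ≤ ∫ x, f x ∂(cellLaw K k) := by
    refine integral_mono_ae (integrable_const _) hint ?_
    filter_upwards [ae_cond_mem (μ := (volume : Measure I)) (measurableSet_cell K k)] with x hxc
    have hxc : (k : ℝ) / K ≤ (x : ℝ) ∧ (x : ℝ) ≤ ((k : ℝ) + 1) / K := hxc
    have h3 : |(xstar : ℝ) - x| ≤ 1 / K := by
      have : ((k : ℝ) + 1) / K = k / K + 1 / K := by ring
      rw [abs_le]; constructor <;> linarith [hxc.1, hxc.2]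
    have h4 : L * |(xstar : ℝ) - (x : ℝ)| ^ α ≤ L * (1 / K : ℝ) ^ α :=
      mul_le_mul_of_nonneg_left (Real.rpow_le_rpow (abs_nonneg _) h3 hα.le) hL.le
    have := (le_abs_self _).trans (hx x)
    linarith
  simpa using this

section History

variable {Ω : Type*} {A : ℕ → Ω → ℕ} {X : ℕ → Ω → I} {Y : ℕ → Ω → ℝ}

theorem playsLaw_history {p j t : ℕ} (ht : regimeEnd p j ≤ t) (ω : Ω) :
    playsLaw p j t (history A X Y t ω) = ((regimeLength p j : ℕ) : ℝ≥0∞)⁻¹ •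
      ∑ r ∈ Finset.Ico (regimeEnd p (j - 1)) (regimeEnd p j), Measure.dirac (X r ω) := by
  rw [playsLaw]
  congr 1
  refine (Fin.sum_univ_eq_sum_range (fun s => if regimeEnd p (j - 1) ≤ s ∧ s < regimeEnd p j
      then Measure.dirac (X s ω) else 0) t).trans ?_
  rw [← Finset.sum_filter]
  refine Finset.sum_congr ?_ fun _ _ => rfl
  ext r
  simp only [Finset.mem_filter, Finset.mem_range, Finset.mem_Ico]
  omega

theorem isProbabilityMeasure_playsLaw {p j t : ℕ} (hj : 1 ≤ j) (ht : regimeEnd p j ≤ t) (ω : Ω) :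
    IsProbabilityMeasure (playsLaw p j t (history A X Y t ω)) := by
  constructor
  rw [playsLaw_history ht]
  simp only [Measure.smul_apply, Measure.finsetSum_apply, measure_univ, Finset.sum_const,
    Nat.card_Ico, smul_eq_mul, nsmul_eq_mul, mul_one]
  rw [regimeEnd_eq hj, Nat.add_sub_cancel_left]
  refine ENNReal.inv_mul_cancel ?_ (ENNReal.natCast_ne_top _)
  exact_mod_cast (regimeLength_pos p j).ne'

theorem integral_playsLaw {p j t : ℕ} (ht : regimeEnd p j ≤ t) (ω : Ω) (f : I → ℝ) :
    ∫ x, f x ∂(playsLaw p j t (history A X Y t ω)) = (regimeLength p j : ℝ)⁻¹ *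
      ∑ r ∈ Finset.Ico (regimeEnd p (j - 1)) (regimeEnd p j), f (X r ω) := by
  rw [playsLaw_history ht, integral_smul_measure, integral_finsetSum_measure fun r _ =>
    integrable_dirac (by simp)]
  simp

theorem isProbabilityMeasure_armLaw {p i t a : ℕ} (ht : regimeEnd p (i - 1) ≤ t)
    (ha : a < numArms p i) (ω : Ω) :
    IsProbabilityMeasure (armLaw p i t (history A X Y t ω, a)) := by
  unfold armLaw
  split_ifs with h
  · exact isProbabilityMeasure_cellLaw h
  · refine isProbabilityMeasure_playsLaw (by omega) ((regimeEnd_mono p ?_).trans ht) ω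
    simp only [numArms] at ha
    dsimp only at h ⊢
    omega

/-- The regimes replayed in regime `i` are over when it begins. Its arms are therefore frozen, which
makes it a genuine bandit problem with fixed, though random, means. -/
theorem armLaw_history_eq {p i t a : ℕ} (ht : regimeEnd p (i - 1) ≤ t)
    (ha : a < numArms p i) (ω : Ω) :
    armLaw p i t (history A X Y t ω, a) = armLaw p i (regimeEnd p (i - 1))
      (history A X Y (regimeEnd p (i - 1)) ω, a) := by
  unfold armLaw
  dsimp only
  split_ifs with h
  · rfl
  · have : regimeEnd p (a - numCells p i + 1) ≤ regimeEnd p (i - 1) := by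
      apply regimeEnd_mono
      simp only [numArms] at ha
      omega
    rw [playsLaw_history (this.trans ht), playsLaw_history this]

/-- The mean reward of arm `a` in regime `i`. -/
def armMean (f : I → ℝ) (p i : ℕ) (A : ℕ → Ω → ℕ) (X : ℕ → Ω → I) (Y : ℕ → Ω → ℝ) (a : ℕ) (ω : Ω) :
    ℝ :=
  ∫ x, f x ∂(armKernel p i (regimeEnd p (i - 1)) (history A X Y (regimeEnd p (i - 1)) ω, a))

theorem armMean_eq {f : I → ℝ} {p i t a : ℕ} (ht : regimeEnd p (i - 1) ≤ t)
    (ha : a < numArms p i) (ω : Ω) :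
    armMean f p i A X Y a ω = ∫ x, f x ∂(armKernel p i t (history A X Y t ω, a)) := by
  change ∫ x, f x ∂(armLaw _ _ _ _) = ∫ x, f x ∂(armLaw _ _ _ _)
  rw [armLaw_history_eq ht ha]

theorem armMean_cell {f : I → ℝ} {p i a : ℕ} (ha : a < numCells p i) (ω : Ω) :
    armMean f p i A X Y a ω = ∫ x, f x ∂(cellLaw (numCells p i) a) := by
  change ∫ x, f x ∂(armLaw _ _ _ _) = _
  rw [armLaw, if_pos ha]

theorem armMean_plays {f : I → ℝ} {p i j : ℕ} (hj : 1 ≤ j) (hji : j < i) (ω : Ω) :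
    armMean f p i A X Y (numCells p i + (j - 1)) ω = (regimeLength p j : ℝ)⁻¹ *
      ∑ r ∈ Finset.Ico (regimeEnd p (j - 1)) (regimeEnd p j), f (X r ω) := by
  change ∫ x, f x ∂(armLaw _ _ _ _) = _
  rw [armLaw, if_neg (by dsimp only; omega),
    ← integral_playsLaw (regimeEnd_mono p (by omega : j ≤ i - 1)) ω]
  dsimp only
  rw [show numCells p i + (j - 1) - numCells p i + 1 = j by omega]

theorem armMean_mem_Icc {f : I → ℝ} (hfm : Measurable f) (hf : ∀ x, f x ∈ Set.Icc (0 : ℝ) 1)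
    {p i a : ℕ} (ha : a < numArms p i) (ω : Ω) :
    armMean f p i A X Y a ω ∈ Set.Icc (0 : ℝ) 1 := by
  have : IsProbabilityMeasure (armKernel p i (regimeEnd p (i - 1))
      (history A X Y (regimeEnd p (i - 1)) ω, a)) := isProbabilityMeasure_armLaw le_rfl ha ω
  refine ⟨integral_nonneg fun x => (hf x).1, ?_⟩
  refine (integral_mono (Integrable.of_mem_Icc 0 1 hfm.aemeasurable
    (Filter.Eventually.of_forall hf)) (integrable_const 1) fun x => (hf x).2).trans (by simp)

end History

/-! ### The reward of a round as feedback for MOSS -/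

theorem HasSubgaussianMGF.lintegral_exp_le {Ω : Type*} [MeasurableSpace Ω] {P : Measure Ω}
    {Z : Ω → ℝ} {c : ℝ≥0} (h : HasSubgaussianMGF Z c P) (l : ℝ) :
    ∫⁻ ω, ENNReal.ofReal (Real.exp (l * Z ω)) ∂P ≤ ENNReal.ofReal (Real.exp (c * l ^ 2 / 2)) := by
  rw [← ofReal_integral_eq_lintegral_ofReal (h.integrable_exp_mul l)
    (Filter.Eventually.of_forall fun _ => (Real.exp_pos _).le)]
  exact ENNReal.ofReal_le_ofReal (h.mgf_le l)

/-- The kernel inequality is required only almost surely along `Z`: `armKernel` is known to be a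
probability only at actual histories and admissible arms. -/
theorem lintegral_le_of_hasCondDistrib {Ω 𝓩 𝓧 : Type*} [MeasurableSpace Ω] [MeasurableSpace 𝓩]
    [MeasurableSpace 𝓧] {P : Measure Ω} [SFinite P] {Z : Ω → 𝓩} {X : Ω → 𝓧} {κ : Kernel 𝓩 𝓧}
    [IsSFiniteKernel κ] (h : HasCondDistrib X Z κ P) {F : 𝓩 × 𝓧 → ℝ≥0∞} (hF : Measurable F)
    {G : 𝓩 → ℝ≥0∞} (hG : Measurable G)
    (hle : ∀ᵐ ω ∂P, MeasurableSet {z | ∫⁻ x, F (z, x) ∂(κ z) ≤ G z} →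
      ∫⁻ x, F (Z ω, x) ∂(κ (Z ω)) ≤ G (Z ω)) :
    ∫⁻ ω, F (Z ω, X ω) ∂P ≤ ∫⁻ ω, G (Z ω) ∂P := by
  have hZ : AEMeasurable Z P := h.aemeasurable_fst
  have hms : MeasurableSet {z | ∫⁻ x, F (z, x) ∂(κ z) ≤ G z} :=
    measurableSet_le (Measurable.lintegral_kernel_prod_right' hF) hG
  calc ∫⁻ ω, F (Z ω, X ω) ∂P = ∫⁻ q, F q ∂(P.map fun ω => (Z ω, X ω)) :=
        (lintegral_map' hF.aemeasurable h.aemeasurable).symm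
    _ = ∫⁻ z, ∫⁻ x, F (z, x) ∂(κ z) ∂(P.map Z) := by
        rw [h.map_eq, Measure.lintegral_compProd hF]
    _ ≤ ∫⁻ z, G z ∂(P.map Z) := by
        refine lintegral_mono_ae ((ae_map_iff hZ hms).2 ?_)
        filter_upwards [hle] with ω hω using hω hms
    _ = ∫⁻ ω, G (Z ω) ∂P := lintegral_map' hG.aemeasurable hZ

theorem IsEnvironment.measurable {f : I → ℝ} {ν : ℕ → Kernel I ℝ} (hν : IsEnvironment f ν) :
    Measurable f := by
  have : f = fun x => ∫ y, y ∂(ν 0 x) := funext fun x => (hν.integral_eq 0 x).symm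
  rw [this]
  have := hν.isMarkovKernel 0
  exact (stronglyMeasurable_id.integral_kernel (κ := ν 0)).measurable

theorem measurable_history {Ω : Type*} [MeasurableSpace Ω] {A : ℕ → Ω → ℕ} {X : ℕ → Ω → I}
    {Y : ℕ → Ω → ℝ} (hA : ∀ t, Measurable (A t)) (hX : ∀ t, Measurable (X t))
    (hY : ∀ t, Measurable (Y t)) (t : ℕ) : Measurable (history A X Y t) :=
  measurable_pi_lambda _ fun s => (hA s).prodMk ((hX s).prodMk (hY s))

/-- The information available in round `t`, once the discrete arm has been chosen. -/
abbrev pastAlgebra {Ω : Type*} (A : ℕ → Ω → ℕ) (X : ℕ → Ω → I) (Y : ℕ → Ω → ℝ) (t : ℕ) :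
    MeasurableSpace Ω :=
  MeasurableSpace.comap (fun ω => (history A X Y t ω, A t ω)) inferInstance

namespace IsRun

variable {Ω : Type*} [MeasurableSpace Ω] {P : Measure Ω} {B : ℝ} {T : ℕ}
  {ν : ℕ → Kernel I ℝ} {A : ℕ → Ω → ℕ} {X : ℕ → Ω → I} {Y : ℕ → Ω → ℝ}

theorem measurable_info (h : IsRun P B T ν A X Y) (t : ℕ) :
    Measurable fun ω => (history A X Y t ω, A t ω) :=
  (measurable_history h.measurable_arm h.measurable_play h.measurable_reward t).prodMk
    (h.measurable_arm t)

theorem measurable_armMean (h : IsRun P B T ν A X Y) {f : I → ℝ} (hfm : Measurable f)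
    (p i a : ℕ) : Measurable (armMean f p i A X Y a) :=
  ((hfm.stronglyMeasurable.integral_kernel
    (κ := armKernel p i (regimeEnd p (i - 1)))).measurable).comp
      ((measurable_history h.measurable_arm h.measurable_play h.measurable_reward _).prodMk
        measurable_const)

/-- Split the deviation into `Y - f (X)` and `f (X)` minus the mean of the arm. The first is
`1/4`-subgaussian given the play; the second is so given the arm, by Hoeffding's lemma for values in
`[0, 1]`. Each costs `c² / 8`, whence `c² / 4`. -/
theorem lintegral_exp_le [IsProbabilityMeasure P] (h : IsRun P B T ν A X Y) {f : I → ℝ}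
    (hf : ∀ x, f x ∈ Set.Icc (0 : ℝ) 1) (hν : IsEnvironment f ν) {i t : ℕ}
    (hi : i ∈ Finset.Icc 1 (numRegimes B))
    (ht : t ∈ Finset.Ico (regimeEnd (numRegimes B) (i - 1)) (regimeEnd (numRegimes B) i))
    (htT : t < T) {c : History t × ℕ → ℝ} (hc : Measurable c) {G : History t × ℕ → ℝ≥0∞}
    (hG : Measurable G) :
    ∫⁻ ω, G (history A X Y t ω, A t ω) * ENNReal.ofReal (Real.exp
      (c (history A X Y t ω, A t ω) *
        (Y t ω - ∫ x, f x ∂(armKernel (numRegimes B) i t (history A X Y t ω, A t ω)))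
        - c (history A X Y t ω, A t ω) ^ 2 / 4)) ∂P ≤
      ∫⁻ ω, G (history A X Y t ω, A t ω) ∂P := by
  have hfm := hν.measurable
  set κ := armKernel (numRegimes B) i t with hκ
  set m : History t × ℕ → ℝ := fun q => ∫ x, f x ∂(κ q) with hm
  have hmm : Measurable m := (hfm.stronglyMeasurable.integral_kernel (κ := κ)).measurable
  have := hν.isMarkovKernel t
  have : IsMarkovKernel (rewardKernel ν t) := by unfold rewardKernel; infer_instance
  have step1 := lintegral_le_of_hasCondDistrib (h.reward t htT)
    (F := fun q => G q.1.1 * ENNReal.ofReal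
      (Real.exp (c q.1.1 * (q.2 - m q.1.1) - c q.1.1 ^ 2 / 4)))
    (G := fun q => G q.1 * ENNReal.ofReal
      (Real.exp (c q.1 * (f q.2 - m q.1) - c q.1 ^ 2 / 8)))
    (by fun_prop) (by fun_prop) (Filter.Eventually.of_forall fun ω _ => by
      set z := (history A X Y t ω, A t ω)
      have hsub := HasSubgaussianMGF.lintegral_exp_le (hν.subgaussian t (X t ω)) (c z)
      have hmeas : Measurable fun y : ℝ => ENNReal.ofReal (Real.exp (c z * (y - f (X t ω)))) := by
        fun_prop
      have e1 : ∀ y : ℝ, G z * ENNReal.ofReal (Real.exp (c z * (y - m z) - c z ^ 2 / 4)) =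
          G z * ENNReal.ofReal (Real.exp (c z * (f (X t ω) - m z) - c z ^ 2 / 4)) *
            ENNReal.ofReal (Real.exp (c z * (y - f (X t ω)))) := by
        intro y
        rw [mul_assoc, ← ENNReal.ofReal_mul (Real.exp_pos _).le, ← Real.exp_add]
        congr 3
        ring
      refine (lintegral_congr (μ := ν t (X t ω)) e1).trans_le ?_
      rw [lintegral_const_mul _ hmeas]
      refine (mul_le_mul_right hsub _).trans (le_of_eq ?_)
      rw [mul_assoc, ← ENNReal.ofReal_mul (Real.exp_pos _).le, ← Real.exp_add]
      congr 3
      push_cast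
      ring)
  refine step1.trans ?_
  refine lintegral_le_of_hasCondDistrib (h.play i hi t ht htT)
    (F := fun q => G q.1 * ENNReal.ofReal
      (Real.exp (c q.1 * (f q.2 - m q.1) - c q.1 ^ 2 / 8))) (G := G)
    (by fun_prop) hG ?_
  filter_upwards [h.arm i hi t ht htT] with ω hω _
  have : IsProbabilityMeasure (κ (history A X Y t ω, A t ω)) :=
    isProbabilityMeasure_armLaw (Finset.mem_Ico.1 ht).1 hω.1 ω
  set z := (history A X Y t ω, A t ω)
  have hsub := HasSubgaussianMGF.lintegral_exp_le (hasSubgaussianMGF_of_mem_Icc (μ := κ z)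
    hfm.aemeasurable (Filter.Eventually.of_forall hf)) (c z)
  have hmeas : Measurable fun x : I => ENNReal.ofReal (Real.exp (c z * (f x - m z))) := by
    fun_prop
  have e1 : ∀ x : I, G z * ENNReal.ofReal (Real.exp (c z * (f x - m z) - c z ^ 2 / 8)) =
      G z * ENNReal.ofReal (Real.exp (-(c z ^ 2 / 8))) *
        ENNReal.ofReal (Real.exp (c z * (f x - m z))) := by
    intro x
    rw [mul_assoc, ← ENNReal.ofReal_mul (Real.exp_pos _).le, ← Real.exp_add]
    congr 3
    ring
  refine (lintegral_congr (μ := κ z) e1).trans_le ?_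
  rw [lintegral_const_mul _ hmeas]
  refine (mul_le_mul_right hsub _).trans (le_of_eq ?_)
  rw [mul_assoc, ← ENNReal.ofReal_mul (Real.exp_pos _).le, ← Real.exp_add]
  have : -(c z ^ 2 / 8) + ((‖(1 : ℝ) - 0‖₊ / 2) ^ 2 : ℝ≥0) * c z ^ 2 / 2 = 0 := by
    push_cast
    norm_num
    ring
  rw [this]
  simp

theorem isSubgaussianFeedback [IsProbabilityMeasure P] (h : IsRun P B T ν A X Y) {f : I → ℝ}
    (hf : ∀ x, f x ∈ Set.Icc (0 : ℝ) 1) (hν : IsEnvironment f ν) {i : ℕ}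
    (hi : i ∈ Finset.Icc 1 (numRegimes B)) :
    IsSubgaussianFeedback P (pastAlgebra A X Y) (regimeEnd (numRegimes B) (i - 1))
      (min T (regimeEnd (numRegimes B) i)) A Y (armMean f (numRegimes B) i A X Y) := by
  have hinfo : ∀ t, Measurable[pastAlgebra A X Y t] fun ω => (history A X Y t ω, A t ω) :=
    fun t => comap_measurable _
  have hhist : ∀ t, Measurable[pastAlgebra A X Y t] (history A X Y t) :=
    fun t => measurable_fst.comp (hinfo t)
  refine ⟨fun t => (h.measurable_info t).comap_le, fun t r hr => ?_, fun t r hr => ?_,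
    fun t ht a => ?_, fun t ht c G hc hG => ?_⟩
  · rcases hr.lt_or_eq with hr | rfl
    · exact (measurable_fst.comp (measurable_pi_apply (⟨r, hr⟩ : Fin t))).comp (hhist t)
    · exact measurable_snd.comp (hinfo r)
  · exact (measurable_snd.comp (measurable_snd.comp
      (measurable_pi_apply (⟨r, hr⟩ : Fin t)))).comp (hhist t)
  · have h1 : Measurable[pastAlgebra A X Y t]
        (history A X Y (regimeEnd (numRegimes B) (i - 1))) :=
      (measurable_pi_lambda (fun (q : History t) (r : Fin (regimeEnd (numRegimes B) (i - 1))) =>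
        q ⟨r, r.2.trans_le ht⟩) fun r => measurable_pi_apply _).comp (hhist t)
    exact ((hν.measurable.stronglyMeasurable.integral_kernel
      (κ := armKernel (numRegimes B) i (regimeEnd (numRegimes B) (i - 1)))).measurable).comp
        (h1.prodMk measurable_const)
  · obtain ⟨c', hc', rfl⟩ := hc.exists_eq_measurable_comp
    obtain ⟨G', hG', rfl⟩ := hG.exists_eq_measurable_comp
    simp only [Finset.mem_Ico, lt_min_iff] at ht
    have ht' : t ∈ Finset.Ico (regimeEnd (numRegimes B) (i - 1)) (regimeEnd (numRegimes B) i) :=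
      Finset.mem_Ico.2 ⟨ht.1, ht.2.2⟩
    refine le_trans (le_of_eq (lintegral_congr_ae ?_))
      (h.lintegral_exp_le hf hν hi ht' ht.2.1 hc' hG')
    filter_upwards [h.arm i hi t ht' ht.2.1] with ω hω
    rw [armMean_eq ht.1 hω.1]
    rfl

theorem integral_play_eq [IsProbabilityMeasure P] (h : IsRun P B T ν A X Y) {f : I → ℝ}
    (hfm : Measurable f) (hf : ∀ x, f x ∈ Set.Icc (0 : ℝ) 1) {i t : ℕ}
    (hi : i ∈ Finset.Icc 1 (numRegimes B))
    (ht : t ∈ Finset.Ico (regimeEnd (numRegimes B) (i - 1)) (regimeEnd (numRegimes B) i))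
    (htT : t < T) :
    Integrable (fun ω => armMean f (numRegimes B) i A X Y (A t ω) ω) P ∧
    ∫ ω, armMean f (numRegimes B) i A X Y (A t ω) ω ∂P = ∫ ω, f (X t ω) ∂P := by
  have hlaw := h.play i hi t ht htT
  have hmeas : Measurable fun ω => armMean f (numRegimes B) i A X Y (A t ω) ω :=
    (measurable_from_prod_countable_right (f := fun q : ℕ × Ω =>
      armMean f (numRegimes B) i A X Y q.1 q.2) fun a =>
        h.measurable_armMean hfm _ _ a).comp ((h.measurable_arm t).prodMk measurable_id)
  refine ⟨Integrable.of_mem_Icc 0 1 hmeas.aemeasurable ?_, ?_⟩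
  · filter_upwards [h.arm i hi t ht htT] with ω hω using armMean_mem_Icc hfm hf hω.1 ω
  · set κ := armKernel (numRegimes B) i t with hκ
    have h1 : ∫ ω, f (X t ω) ∂P =
        ∫ q, f q.2 ∂(P.map fun ω => ((history A X Y t ω, A t ω), X t ω)) :=
      (integral_map (((h.measurable_info t).prodMk (h.measurable_play t)).aemeasurable)
        ((hfm.comp measurable_snd).aestronglyMeasurable)).symm
    have : IsProbabilityMeasure (P.map fun ω => (history A X Y t ω, A t ω)) :=
      Measure.isProbabilityMeasure_map (h.measurable_info t).aemeasurable
    have h2 : Integrable (fun q : (History t × ℕ) × I => f q.2)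
        ((P.map fun ω => (history A X Y t ω, A t ω)) ⊗ₘ κ) :=
      Integrable.of_mem_Icc 0 1 (hfm.comp measurable_snd).aemeasurable
        (Filter.Eventually.of_forall fun q => hf q.2)
    rw [h1, hlaw.map_eq, Measure.integral_compProd h2,
      integral_map (h.measurable_info t).aemeasurable
        (hfm.stronglyMeasurable.integral_kernel (κ := κ)).aestronglyMeasurable]
    refine integral_congr_ae ?_
    filter_upwards [h.arm i hi t ht htT] with ω hω
    exact armMean_eq (Finset.mem_Ico.1 ht).1 hω.1 ω

end IsRun

/-! ### Size of the bandit problem of one regime, and its regret. -/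

theorem numArms_le {p i : ℕ} (hi : 1 ≤ i) (hip : i ≤ p) : numArms p i ≤ regimeLength p i := by
  unfold numArms numCells regimeLength
  rcases hi.eq_or_lt with rfl | hi
  · simp
  · have h1 : 2 ^ (p + 2 - i) ≤ 2 ^ p := Nat.pow_le_pow_right (by norm_num) (by omega)
    have h2 : 2 ^ (p + 1) ≤ 2 ^ (p + i) := Nat.pow_le_pow_right (by norm_num) (by omega)
    have h3 : p < 2 ^ p := Nat.lt_two_pow_self
    rw [pow_succ] at h2
    omega

/-- The cells contribute `4 · 4^p` whatever `i`, and the replayed regimes at most `(p - 1) · 4^p`.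
This is what makes the MOSS bound uniform over regimes. -/
theorem numArms_mul_le {p i : ℕ} (hi : 1 ≤ i) (hip : i ≤ p) :
    numArms p i * regimeLength p i ≤ (2 ^ p) ^ 2 * (p + 3) := by
  unfold numArms numCells regimeLength
  have h1 : 2 ^ (p + 2 - i) * 2 ^ (p + i) = 4 * (2 ^ p) ^ 2 := by
    rw [← pow_add, show p + 2 - i + (p + i) = p * 2 + 2 by omega, pow_add, pow_mul]; ring
  have h2 : (i - 1) * 2 ^ (p + i) ≤ (p - 1) * (2 ^ p) ^ 2 := by
    rw [← pow_mul]
    exact Nat.mul_le_mul (by omega) (Nat.pow_le_pow_right (by norm_num) (by omega))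
  obtain ⟨q, rfl⟩ := Nat.exists_eq_add_of_le' (hi.trans hip)
  simp only [Nat.add_sub_cancel] at h2
  rw [add_mul, h1]
  nlinarith

/-- Regret of the rounds of regime `i` that are played, relative to its arm `b`. -/
theorem IsRun.regime_regret_le {Ω : Type*} [MeasurableSpace Ω] {P : Measure Ω}
    [IsProbabilityMeasure P] {B : ℝ} {T : ℕ} {ν : ℕ → Kernel I ℝ} {A : ℕ → Ω → ℕ} {X : ℕ → Ω → I}
    {Y : ℕ → Ω → ℝ} (h : IsRun P B T ν A X Y) {f : I → ℝ} (hf : ∀ x, f x ∈ Set.Icc (0 : ℝ) 1)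
    (hν : IsEnvironment f ν) {i : ℕ} (hi : i ∈ Finset.Icc 1 (numRegimes B)) {b : ℕ}
    (hb : b < numArms (numRegimes B) i) :
    ∑ t ∈ Finset.Ico (regimeEnd (numRegimes B) (i - 1)) (min T (regimeEnd (numRegimes B) i)),
        (∫ ω, armMean f (numRegimes B) i A X Y b ω ∂P - ∫ ω, f (X t ω) ∂P) ≤
      40 * (2 ^ numRegimes B * √(numRegimes B + 3)) := by
  set p := numRegimes B with hp
  obtain ⟨hi1, hip⟩ := Finset.mem_Icc.1 hi
  rcases le_total (min T (regimeEnd p i)) (regimeEnd p (i - 1)) with hse | hse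
  · rw [Finset.Ico_eq_empty_of_le hse, Finset.sum_empty]
    positivity
  have hmem : ∀ t ∈ Finset.Ico (regimeEnd p (i - 1)) (min T (regimeEnd p i)),
      t ∈ Finset.Ico (regimeEnd p (i - 1)) (regimeEnd p i) ∧ t < T := by
    intro t ht
    simp only [Finset.mem_Ico, lt_min_iff] at ht ⊢
    tauto
  have hmoss := (h.isSubgaussianFeedback hf hν hi).moss_regret_le
    (n := regimeLength p i) (K := numArms p i) (Nat.pos_of_ne_zero (by omega)) (numArms_le hi1 hip)
    hse (by rw [← hp, ← regimeEnd_eq hi1]; exact min_le_right _ _)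
    (fun t ht => h.arm i hi t (hmem t ht).1 (hmem t ht).2)
    (fun a ha ω => armMean_mem_Icc hν.measurable hf ha ω) hb
  have hbint : Integrable (armMean f p i A X Y b) P :=
    Integrable.of_mem_Icc 0 1 (h.measurable_armMean hν.measurable p i b).aemeasurable
      (Filter.Eventually.of_forall fun ω => armMean_mem_Icc hν.measurable hf hb ω)
  have hplay := fun t ht =>
    h.integral_play_eq hν.measurable hf hi (hmem t ht).1 (hmem t ht).2
  have hsum := integral_finsetSum (μ := P)
    (f := fun t ω => armMean f p i A X Y b ω - armMean f p i A X Y (A t ω) ω)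
    (Finset.Ico (regimeEnd p (i - 1)) (min T (regimeEnd p i)))
    fun t ht => hbint.sub (hplay t ht).1
  have e : ∀ t ∈ Finset.Ico (regimeEnd p (i - 1)) (min T (regimeEnd p i)),
      ∫ ω, armMean f p i A X Y b ω ∂P - ∫ ω, f (X t ω) ∂P =
        ∫ ω, (armMean f p i A X Y b ω - armMean f p i A X Y (A t ω) ω) ∂P := by
    intro t ht
    rw [integral_sub hbint (hplay t ht).1, (hplay t ht).2]
  rw [Finset.sum_congr rfl e, ← hsum]
  refine hmoss.trans ?_
  gcongr
  rw [Real.sqrt_le_left (by positivity), mul_pow, Real.sq_sqrt (by positivity)]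
  exact_mod_cast numArms_mul_le hi1 hip

/-! ### The regret of MeDZO -/

theorem regimeEnd_add (p i : ℕ) : regimeEnd p i + 2 ^ (p + 1) = 2 ^ (p + i + 1) := by
  induction i with
  | zero => simp [regimeEnd]
  | succ i ih =>
    rw [regimeEnd_succ, regimeLength, add_right_comm, ih, ← add_assoc p i 1, pow_succ 2 (p + i + 1)]
    ring

theorem numCells_succ {p i : ℕ} (hi : i ≤ p) : numCells p i = 2 * numCells p (i + 1) := by
  rw [numCells, numCells, ← pow_succ']
  congr 1
  omega

/-- Per-regime bounds on partial sums add up. -/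
theorem sum_le_of_regimes {r : ℕ → ℝ} {p T : ℕ} {ρ D : ℝ}
    (h : ∀ i ∈ Finset.Icc 1 p, ∑ t ∈ Finset.Ico (regimeEnd p (i - 1)) (min T (regimeEnd p i)), r t ≤
      (min T (regimeEnd p i) - regimeEnd p (i - 1) : ℕ) * ρ + D) {k : ℕ} (hk : k ≤ p) (hD : 0 ≤ D) :
    ∑ t ∈ Finset.range (min T (regimeEnd p k)), r t ≤ (min T (regimeEnd p k) : ℕ) * ρ + k * D := by
  induction k with
  | zero => simp [regimeEnd]
  | succ k ih =>
    have hmono : regimeEnd p k ≤ regimeEnd p (k + 1) := regimeEnd_mono p k.le_succ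
    have ih := ih (by omega)
    rcases le_total T (regimeEnd p k) with hT | hT
    · rw [min_eq_left hT] at ih
      rw [min_eq_left (hT.trans hmono)]
      push_cast
      linarith
    · rw [min_eq_right hT] at ih
      have hle : regimeEnd p k ≤ min T (regimeEnd p (k + 1)) := le_min hT hmono
      have := h (k + 1) (Finset.mem_Icc.2 ⟨by omega, hk⟩)
      rw [Nat.add_sub_cancel, Nat.cast_sub hle] at this
      rw [← Finset.sum_range_add_sum_Ico _ hle]
      push_cast at this ⊢
      linarith

/-- Among the dyadic discretizations, each one is either fine enough or comes after one of
the critical size. -/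
theorem le_numCells_or_exists {p : ℕ} {κ : ℝ} (h1 : κ ≤ numCells p 1) {i : ℕ} (hi : 1 ≤ i)
    (hip : i ≤ p) :
    κ ≤ numCells p i ∨ ∃ j, 1 ≤ j ∧ j < i ∧ κ ≤ numCells p j ∧ (numCells p j : ℝ) ≤ 2 * κ := by
  induction i, hi using Nat.le_induction with
  | base => exact Or.inl h1
  | succ i hi ih =>
    rcases ih (by omega) with h | ⟨j, hj1, hji, hj⟩
    · rcases le_or_gt κ (numCells p (i + 1)) with h' | h'
      · exact Or.inl h'
      · refine Or.inr ⟨i, hi, by omega, h, ?_⟩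
        rw [numCells_succ (by omega)]
        push_cast
        linarith
    · exact Or.inr ⟨j, hj1, by omega, hj⟩

/-- A sequence of per-round regrets in which every regime is controlled by its own discretization
and by the average of every previous regime. -/
theorem sum_le_of_two_controls {r : ℕ → ℝ} {p T : ℕ} {L α Λ κ D : ℝ} (hα : 0 < α) (hκ : 0 < κ)
    (hD : 0 ≤ D) (hΛ : 0 ≤ Λ) (hL : L = Λ * κ ^ α) (hκ1 : κ ≤ numCells p 1)
    (hT : T ≤ regimeEnd p p)
    (hcell : ∀ i ∈ Finset.Icc 1 p,
      ∑ t ∈ Finset.Ico (regimeEnd p (i - 1)) (min T (regimeEnd p i)), r t ≤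
        (min T (regimeEnd p i) - regimeEnd p (i - 1) : ℕ) * (L * (1 / numCells p i : ℝ) ^ α) + D)
    (hplays : ∀ i ∈ Finset.Icc 1 p, ∀ j, 1 ≤ j → j < i →
      ∑ t ∈ Finset.Ico (regimeEnd p (i - 1)) (min T (regimeEnd p i)), r t ≤
        (min T (regimeEnd p i) - regimeEnd p (i - 1) : ℕ) * ((regimeLength p j : ℝ)⁻¹ *
          ∑ t ∈ Finset.Ico (regimeEnd p (j - 1)) (regimeEnd p j), r t) + D) :
    ∑ t ∈ Finset.range T, r t ≤ T * (Λ + D * (κ / (2 * (2 ^ p) ^ 2))) + p * D := by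
  have hbias : ∀ i, κ ≤ numCells p i → L * (1 / numCells p i : ℝ) ^ α ≤ Λ := by
    intro i hi
    have hK : (0 : ℝ) < numCells p i := by exact_mod_cast numCells_pos p i
    have : L * (1 / numCells p i : ℝ) ^ α = Λ * (κ / numCells p i) ^ α := by
      rw [hL, mul_assoc, ← Real.mul_rpow hκ.le (by positivity), mul_one_div]
    rw [this]
    exact mul_le_of_le_one_right hΛ
      (Real.rpow_le_one (by positivity) ((div_le_one hK).2 hi) hα.le)
  have hext : 0 ≤ D * (κ / (2 * (2 ^ p) ^ 2)) := by positivity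
  have hreg : ∀ i ∈ Finset.Icc 1 p,
      ∑ t ∈ Finset.Ico (regimeEnd p (i - 1)) (min T (regimeEnd p i)), r t ≤
        (min T (regimeEnd p i) - regimeEnd p (i - 1) : ℕ) *
          (Λ + D * (κ / (2 * (2 ^ p) ^ 2))) + D := by
    intro i hi
    obtain ⟨hi1, hip⟩ := Finset.mem_Icc.1 hi
    rcases le_numCells_or_exists hκ1 hi1 hip with h | ⟨j, hj1, hji, hj, hj2⟩
    · refine (hcell i hi).trans ?_
      gcongr
      linarith [hbias i h]
    -- Either regime `i` is never played, or regime `j < i` was played in full and its bound is not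
    -- truncated by `T`.
    · rcases le_total T (regimeEnd p (i - 1)) with hTi | hTi
      · rw [Finset.Ico_eq_empty_of_le ((min_le_left _ _).trans hTi), Finset.sum_empty]
        positivity
      · refine (hplays i hi j hj1 hji).trans ?_
        gcongr
        have hc := hcell j (Finset.mem_Icc.2 ⟨hj1, by omega⟩)
        rw [min_eq_right ((regimeEnd_mono p (by omega : j ≤ i - 1)).trans hTi),
          show regimeEnd p j - regimeEnd p (j - 1) = regimeLength p j by
            rw [regimeEnd_eq hj1]; omega] at hc
        have hl : (0 : ℝ) < regimeLength p j := by exact_mod_cast regimeLength_pos p j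
        have hprod : (numCells p j : ℝ) * regimeLength p j = 4 * (2 ^ p) ^ 2 := by
          rw [numCells, regimeLength]
          push_cast
          rw [← pow_add, show p + 2 - j + (p + j) = p * 2 + 2 by omega, pow_add, pow_mul]
          ring
        rw [inv_mul_le_iff₀ hl]
        -- From `K_j ΔT_j = 4 · 4^p` and `K_j ≤ 2κ`: the critical regime is long enough to spread
        -- its MOSS regret `D` thinly.
        have h2 : 1 ≤ regimeLength p j * (κ / (2 * (2 ^ p) ^ 2)) := by
          rw [mul_div_assoc', le_div_iff₀ (by positivity)]
          nlinarith
        have h3 := mul_le_mul_of_nonneg_left h2 hD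
        have h4 := mul_le_mul_of_nonneg_left (hbias j hj) hl.le
        linarith
  have := sum_le_of_regimes hreg le_rfl hD
  rwa [min_eq_left hT] at this

/-- Both controls come from comparing with a deterministic arm index: the cell of a maximizer, or
the arm replaying regime `j`. The mean of the latter is the average of `f` over the plays of that
regime, so its expected gap is the average regret there. -/
theorem IsRun.regret_le {Ω : Type*} [MeasurableSpace Ω] {P : Measure Ω}
    [IsProbabilityMeasure P] {B : ℝ} {T : ℕ} {ν : ℕ → Kernel I ℝ} {A : ℕ → Ω → ℕ} {X : ℕ → Ω → I}
    {Y : ℕ → Ω → ℝ} (h : IsRun P B T ν A X Y) {f : I → ℝ} {L α Λ κ : ℝ} (hL : 0 < L) (hα : 0 < α)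
    (hf : f ∈ holderClass L α) (hν : IsEnvironment f ν) (hκ : 0 < κ) (hΛ : 0 ≤ Λ)
    (hLκ : L = Λ * κ ^ α) (hκ1 : κ ≤ numCells (numRegimes B) 1)
    (hT : T ≤ regimeEnd (numRegimes B) (numRegimes B)) :
    regret P f T X ≤ T * (Λ + 40 * (2 ^ numRegimes B * √(numRegimes B + 3)) *
      (κ / (2 * (2 ^ numRegimes B) ^ 2))) +
        numRegimes B * (40 * (2 ^ numRegimes B * √(numRegimes B + 3))) := by
  obtain ⟨hf01, xstar, hmax, hx⟩ := hf
  have hfm := hν.measurable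
  have hsup : ⨆ x, f x = f xstar :=
    le_antisymm (ciSup_le hmax) (le_ciSup ⟨f xstar, by rintro _ ⟨x, rfl⟩; exact hmax x⟩ xstar)
  have hint : ∀ t, Integrable (fun ω => f (X t ω)) P := fun t =>
    Integrable.of_mem_Icc 0 1 (hfm.comp (h.measurable_play t)).aemeasurable
      (Filter.Eventually.of_forall fun ω => hf01 _)
  set p := numRegimes B with hp
  set r : ℕ → ℝ := fun t => f xstar - ∫ ω, f (X t ω) ∂P with hr
  have hregret : regret P f T X = ∑ t ∈ Finset.range T, r t := by
    rw [regret, hsup, integral_finsetSum _ fun t _ => hint t]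
    simp [hr]
  have hctrl : ∀ i ∈ Finset.Icc 1 p, ∀ b < numArms p i,
      ∑ t ∈ Finset.Ico (regimeEnd p (i - 1)) (min T (regimeEnd p i)), r t ≤
        (min T (regimeEnd p i) - regimeEnd p (i - 1) : ℕ) *
          (f xstar - ∫ ω, armMean f p i A X Y b ω ∂P) + 40 * (2 ^ p * √(p + 3)) := by
    intro i hi b hb
    have h1 := h.regime_regret_le hf01 hν hi hb
    rw [← hp] at h1
    have h2 : ∑ t ∈ Finset.Ico (regimeEnd p (i - 1)) (min T (regimeEnd p i)), r t =
        ∑ _t ∈ Finset.Ico (regimeEnd p (i - 1)) (min T (regimeEnd p i)),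
          (f xstar - ∫ ω, armMean f p i A X Y b ω ∂P) +
        ∑ t ∈ Finset.Ico (regimeEnd p (i - 1)) (min T (regimeEnd p i)),
          (∫ ω, armMean f p i A X Y b ω ∂P - ∫ ω, f (X t ω) ∂P) := by
      rw [← Finset.sum_add_distrib]
      refine Finset.sum_congr rfl fun t _ => ?_
      simp only [hr]
      ring
    rw [h2, Finset.sum_const, Nat.card_Ico, nsmul_eq_mul]
    linarith
  rw [hregret]
  refine sum_le_of_two_controls hα hκ (by positivity) hΛ hLκ hκ1 hT (fun i hi => ?_)
    fun i hi j hj1 hji => ?_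
  · obtain ⟨b, hb, hgap⟩ := exists_integral_cellLaw_ge hL hα hfm hf01 hx (numCells_pos p i)
    refine (hctrl i hi b (by rw [numArms]; omega)).trans ?_
    simp only [armMean_cell hb, integral_const, probReal_univ, one_smul]
    gcongr
    linarith
  · refine (hctrl i hi (numCells p i + (j - 1)) (by rw [numArms]; omega)).trans (le_of_eq ?_)
    simp only [armMean_plays hj1 hji, integral_const_mul]
    rw [integral_finsetSum _ fun t _ => hint t]
    simp only [hr, Finset.sum_sub_distrib, Finset.sum_const, Nat.card_Ico, nsmul_eq_mul]
    rw [show regimeEnd p j - regimeEnd p (j - 1) = regimeLength p j by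
      rw [regimeEnd_eq hj1]; omega]
    have hl : (regimeLength p j : ℝ) ≠ 0 := by exact_mod_cast (regimeLength_pos p j).ne'
    field_simp

theorem regret_le_rounds {Ω : Type*} [MeasurableSpace Ω] {P : Measure Ω}
    [IsProbabilityMeasure P] {f : I → ℝ} (hf : ∀ x, f x ∈ Set.Icc (0 : ℝ) 1) (T : ℕ)
    (X : ℕ → Ω → I) : regret P f T X ≤ T := by
  rw [regret]
  have h1 : 0 ≤ ∫ ω, ∑ t ∈ Finset.range T, f (X t ω) ∂P :=
    integral_nonneg fun ω => Finset.sum_nonneg fun t _ => (hf _).1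
  have h2 : ⨆ x, f x ≤ 1 := ciSup_le fun x => (hf x).2
  have h3 : (T : ℝ) * ⨆ x, f x ≤ T := mul_le_of_le_one_right (Nat.cast_nonneg T) h2
  linarith

/-- Here `p + 3 ≤ 3 l ≤ 1.75² l` and `80 p + 20 ≤ 130 l`, so the product is at most `227.5 l^(3/2)`.
-/
theorem coeff_le {l p : ℝ} (hl : 2 ≤ l) (hp0 : 0 ≤ p) (hp : p ≤ l + 1) :
    1 + (80 * p + 20) * √(p + 3) ≤ 412 * (l * √l) := by
  have hs : 1 ≤ √l := Real.one_le_sqrt.2 (by linarith)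
  have h1 : √(p + 3) ≤ 1.75 * √l := by
    rw [Real.sqrt_le_left (by positivity), mul_pow, Real.sq_sqrt (by linarith)]
    linarith
  have h2 : 80 * p + 20 ≤ 130 * l := by linarith
  have h3 : (80 * p + 20) * √(p + 3) ≤ 130 * l * (1.75 * √l) := by gcongr
  have h4 : 1 ≤ l * √l := by nlinarith
  linarith

theorem rpow_three_halves {l : ℝ} (hl : 0 ≤ l) : l ^ (3 / 2 : ℝ) = l * √l := by
  rw [show (3 / 2 : ℝ) = 1 + 1 / 2 by norm_num, Real.rpow_add_of_nonneg hl (by norm_num)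
    (by norm_num), Real.rpow_one, Real.sqrt_eq_rpow]

end MeDZO

end

/-! ### Choice of the critical grid size, and the final constant. -/

theorem theorem2 (B : ℝ) (T : ℕ) (hBT : √(T : ℝ) ≤ B) (hB : √(2 : ℝ) ≤ B)
    (L α : ℝ) (hL : 0 < L) (hα : 0 < α)
    (f : I → ℝ) (hf : f ∈ MeDZO.holderClass L α)
    (ν : ℕ → Kernel I ℝ) (hν : MeDZO.IsEnvironment f ν)
    {Ω : Type*} [MeasurableSpace Ω] (P : Measure Ω) [IsProbabilityMeasure P]
    (A : ℕ → Ω → ℕ) (X : ℕ → Ω → I) (Y : ℕ → Ω → ℝ)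
    (hrun : MeDZO.IsRun P B T ν A X Y) :
    MeDZO.regret P f T X ≤
      412 * Real.logb 2 B ^ (3 / 2 : ℝ) *
        max B (T * L ^ (1 / (α + 1)) * B ^ (-α / (α + 1))) := by
  have hB0 : 0 < B := (Real.sqrt_pos.2 (by norm_num)).trans_le hB
  set l := Real.logb 2 B with hl
  have hl2 : (2 : ℝ) ^ l = B := Real.rpow_logb (by norm_num) (by norm_num) hB0
  have hlhalf : 1 / 2 ≤ l := by
    rw [hl, Real.le_logb_iff_rpow_le (by norm_num) hB0, ← Real.sqrt_eq_rpow]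
    exact hB
  have hTB : (T : ℝ) ≤ B ^ 2 := (Real.sqrt_le_left hB0.le).1 hBT
  set R := max B (T * L ^ (1 / (α + 1)) * B ^ (-α / (α + 1))) with hR
  have hBR : B ≤ R := le_max_left _ _
  have hR0 : 0 < R := hB0.trans_le hBR
  rw [MeDZO.rpow_three_halves (by linarith)]
  have htriv : MeDZO.regret P f T X ≤ T := MeDZO.regret_le_rounds hf.1 T X
  have hcoef : 4 ≤ 412 * (l * √l) := by
    have : 1 / 2 ≤ √l := Real.le_sqrt_of_sq_le (by linarith)
    nlinarith
  -- For small `B` the trivial bound suffices, as `T ≤ B² ≤ 4 B`. Beyond it `log₂ B ≥ 2`, as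
  -- `coeff_le` requires.
  rcases le_or_gt B 4 with hB4 | hB4
  · have h1 : (T : ℝ) ≤ 4 * R := by nlinarith
    exact htriv.trans (h1.trans (mul_le_mul_of_nonneg_right hcoef hR0.le))
  -- The solution of `L κ^(-α) = κ / B`, which equates the bias of a grid of size `κ` with the
  -- per-round cost of replaying, up to the factor `√(p + 3)`.
  set κ : ℝ := (L * B) ^ (1 / (α + 1)) with hκ
  have hκ0 : 0 < κ := by positivity
  have hα1 : α + 1 ≠ 0 := by positivity
  have hΛ : L ^ (1 / (α + 1)) * B ^ (-α / (α + 1)) = κ / B := by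
    rw [hκ, Real.mul_rpow hL.le hB0.le, mul_div_assoc]
    congr 1
    rw [← Real.rpow_sub_one hB0.ne']
    congr 1
    field_simp
    ring
  have hTR : T * (κ / B) ≤ R := by
    rw [← hΛ, ← mul_assoc]
    exact le_max_right _ _
  -- If `κ > B` the target exceeds `T` and the trivial bound wins. Otherwise the finest grid, with
  -- `2^(p+1) ≥ 2 B` cells, is finer than `κ`.
  rcases lt_or_ge B κ with hBκ | hκB
  · have h1 : (T : ℝ) ≤ T * (κ / B) :=
      le_mul_of_one_le_right (Nat.cast_nonneg T) ((one_le_div hB0).2 hBκ.le)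
    nlinarith
  have hl2' : 2 ≤ l := by
    rw [hl, Real.le_logb_iff_rpow_le (by norm_num) hB0]
    norm_num
    exact hB4.le
  set p := MeDZO.numRegimes B with hp
  have hlp : l ≤ p := Nat.le_ceil _
  have hpl : (p : ℝ) < l + 1 := Nat.ceil_lt_add_one (by linarith)
  have hBp : B ≤ 2 ^ p := by
    rw [← hl2, ← Real.rpow_natCast]
    exact Real.rpow_le_rpow_of_exponent_le (by norm_num) hlp
  have hpB : 2 ^ p ≤ 2 * B := by
    have : (2 : ℝ) * B = 2 ^ (l + 1) := by
      rw [Real.rpow_add_one (by norm_num), hl2, mul_comm]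
    rw [this, ← Real.rpow_natCast]
    exact Real.rpow_le_rpow_of_exponent_le (by norm_num) hpl.le
  have hp1 : 1 ≤ p := by
    have : (1 : ℝ) ≤ p := by linarith
    exact_mod_cast this
  -- The regimes cover all the rounds: their total length is `2 · 4^p - 2 · 2^p ≥ 4^p ≥ B² ≥ T`,
  -- using `p ≥ 1`.
  have hTp : T ≤ MeDZO.regimeEnd p p := by
    have h1 : (T : ℝ) ≤ ((2 ^ p) ^ 2 : ℝ) := hTB.trans (by gcongr)
    have h2 : T ≤ (2 ^ p) ^ 2 := by exact_mod_cast h1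
    have h3 := MeDZO.regimeEnd_add p p
    have h4 : 2 ^ (p + p + 1) = 2 * (2 ^ p) ^ 2 := by ring
    have h5 : 2 ^ 1 ≤ 2 ^ p := Nat.pow_le_pow_right (by norm_num) hp1
    have h6 : 2 ^ (p + 1) = 2 * 2 ^ p := by ring
    nlinarith
  have hLκ : L = κ / B * κ ^ α := by
    have h1 : κ ^ (α + 1) = L * B := by
      rw [hκ, ← Real.rpow_mul (by positivity), one_div_mul_cancel hα1, Real.rpow_one]
    rw [Real.rpow_add_one hκ0.ne'] at h1
    rw [div_mul_eq_mul_div, mul_comm κ, h1]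
    field_simp
  have hκ1 : κ ≤ MeDZO.numCells p 1 := by
    rw [MeDZO.numCells]
    push_cast
    rw [pow_succ]
    linarith
  have hmain := hrun.regret_le hL hα hf hν hκ0 (by positivity) hLκ hκ1 hTp
  rw [← hp] at hmain
  refine hmain.trans ?_
  set q := √((p : ℝ) + 3) with hq
  have hq0 : 0 ≤ q := Real.sqrt_nonneg _
  have h1 : 40 * (2 ^ p * q) * (κ / (2 * (2 ^ p) ^ 2)) ≤ 20 * q * (κ / B) := by
    have : 40 * (2 ^ p * q) * (κ / (2 * (2 ^ p) ^ 2)) = 20 * q * (κ / 2 ^ p) := by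
      have hz : (0 : ℝ) < 2 ^ p := by positivity
      generalize (2 : ℝ) ^ p = z at hz
      field_simp
      ring
    rw [this]
    gcongr
  have h2 : T * (κ / B + 40 * (2 ^ p * q) * (κ / (2 * (2 ^ p) ^ 2))) ≤ (1 + 20 * q) * R := by
    calc _ ≤ T * (κ / B + 20 * q * (κ / B)) := by gcongr
      _ = (1 + 20 * q) * (T * (κ / B)) := by ring
      _ ≤ _ := by gcongr
  have h3 : p * (40 * (2 ^ p * q)) ≤ 80 * p * q * R := by
    calc _ ≤ p * (40 * (2 * R * q)) := by gcongr; linarith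
      _ = _ := by ring
  have h4 := mul_le_mul_of_nonneg_right (MeDZO.coeff_le hl2' (Nat.cast_nonneg p) hpl.le) hR0.le
  rw [← hq] at h4
  linarith
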